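/- **Theorem (consistency of the network GMM estimator).** *Model.* On a probability space $(\Omega,\mathcal F,P)$ and for each $n\ge 1$, let $\mathcal C_n\subseteq\mathcal F$ be a $\sigma$-algebra (common shocks), and let the following be $\mathcal C_n$-measurable: an undirected random network $A_n$ without loops on the nodes $1,\dots,n$, covariates $X_{n,i}$ and exogenous variables $Z_{n,i}$ with values in Euclidean spaces; $\mathbf Z=(Z_{n,i})_i$, $\tilde Z_{n,i}=(1,Z_{n,i}')'$, and $\tilde A_{ij}=A_{ij}/\sum_kA_{ik}$ (a zero row for an isolated node). Let $\nu_{n,i}$ and $e_{n,i}=(e^{(\tau)}_{n,i})_\tau$ ($\tau$ an exposure level) be real random variables such that, conditionally on $\mathcal C_n$, the pairs $(\nu_{n,i},e_{n,i})$, $i\le n$, are independent and each $\nu_{n,i}$ has the standard logistic distribution function $F(v)=1/(1+e^{-v})$. For $b\in\mathbb R^{\dim Z+1}$ and $|\ell|<4$ let $P(b,\ell)=(P_1,\dots,P_n)$ be the (unique) solution of $P_i=F(\tilde Z_{n,i}'b+\ell\sum_j\tilde A_{ij}P_j)$. With true coefficients $\beta_D,\lambda,\beta_X^{(\tau)},\beta_p^{(\tau)}$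 the data are $$D_{n,i}=\mathbb 1\Big\{\tilde Z_{n,i}'\beta_D+\lambda\sum_j\tilde A_{ij}P_j(\beta_D,\lambda)-\nu_{n,i}\ge 0\Big\},\qquad T_{n,i}=T_{n,i}(\mathbf D_n),\qquad Y_{n,i}=Y_{n,i}(\mathbf D_n),$$ where $Y_{n,i}(\mathbf d)=X_{n,i}'\beta_X^{(\tau)}+F(\nu_{n,i})\beta_p^{(\tau)}+e^{(\tau)}_{n,i}$ for $\tau=T_{n,i}(\mathbf d)$. The exposure mapping $T_{n,i}(\mathbf d)\in\mathbb R^{1+q}$ is a function of $A_n$ and $\mathbf d\in\{0,1\}^n$; its first coordinate is $d_i$, and for some $K$ that does not depend on $n$ and $i$ it depends on the other treatments only through those of the nodes $j\ne i$ at path distance at most $K$ from $i$, and is invariant under permutations of these nodes. Put $W_{n,i}=(Y_{n,i},T_{n,i},D_{n,i})$. *Moments and estimator.* Fix two exposure levels $t,t'$. For $\beta=(b,\ell,b_X,b_p,b_X',b_p')$, with $P=P(b,\ell)$ and $M=\operatorname{diag}(1/(P_j(1-P_j)))-\ell\tilde A$, let $\partial_kP=M^{-1}(\tilde Z_{n,jk})_j$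 and $\partial_\ell P=M^{-1}\tilde AP$. The moment function $g((W_{n,i},X_{n,i},\mathbf Z),\beta)$ (which also depends on $i$ and $A_n$) consists of $$(D_i-P_i)\Big(\tilde Z_{ik}+\ell\sum_j\tilde A_{ij}\partial_kP_j\Big)_{k},\qquad (D_i-P_i)\Big(\sum_j\tilde A_{ij}P_j+\ell\sum_j\tilde A_{ij}\partial_\ell P_j\Big),$$ $$\mathbb 1\{T_i=t\}\,2X_i\,r_i,\qquad \mathbb 1\{T_i=t\}\,c_i\,r_i,\qquad r_i=Y_i-X_i'b_X-\tfrac{c_i}{2}b_p,\quad c_i=P_i\text{ if }t_1=1,\ c_i=1+P_i\text{ otherwise},$$ and the last two moments again with $(t',b_X',b_p')$ in place of $(t,b_X,b_p)$. Let $\hat g_n(\beta)=n^{-1}\sum_ig((W_{n,i},X_{n,i},\mathbf Z),\beta)$, $g_n(\beta)=n^{-1}\sum_iE[g((W_{n,i},X_{n,i},\mathbf Z),\beta)\mid\mathcal C_n]$, $\hat Q_n=\hat g_n'\hat\Xi_n\hat g_n$ and $Q_n=g_n'\Xi_ng_n$. Let $\hat\beta_n$ be a measurable minimiser of $\hat Q_n$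 over the parameter space $\Theta$, and let $\beta_0=(\beta_D,\lambda,\beta_X^{(t)},\beta_p^{(t)},\beta_X^{(t')},\beta_p^{(t')})$. *Dependence coefficients.* Let $N(i,s)$ and $N^\partial(i,s)$ be the sets of nodes at path distance at most $s$ and exactly $s$ from $i$, $\delta_n^\partial(s)=n^{-1}\sum_i|N^\partial(i,s)|$. Let $D_{n,i}^{(s)}$ be $D_{n,i}$ with the shocks $\nu_{n,j}$, $j\notin N(i,s)$, replaced by $0$, and let $T_{n,i}^{(s)},Y_{n,i}^{(s)}$ be $T_{n,i},Y_{n,i}$ evaluated with the treatments $D_{n,j}$, $j\notin N(i,s)$, replaced by $0$. Put $\theta^D_{n,s}=2\max_iE[|D_{n,i}-D_{n,i}^{(s)}|\mid\mathcal C_n]$ and $$\theta^W_{n,s}=2\Big(\max_iE[|Y_{n,i}-Y_{n,i}^{(s)}|\mid\mathcal C_n]+\max_iE[\|T_{n,i}-T_{n,i}^{(s)}\|_2\mid\mathcal C_n]\Big)+\max_i|N(i,s)|\,\theta^D_{n,s}.$$ *Assumptions.* 1. For some $\epsilon>0$ and all $n,i$: $E[\|W_{n,i}\|_{1+\epsilon}^{1+\epsilon}\mid\mathcal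 C_n]<\infty$ a.s. 2. $\frac1n\sum_{s\ge1}\delta_n^\partial(s)\,\theta^W_{n,\lfloor(s-1)/4\rfloor}\to0$ a.s. 3. $\Theta\subset\mathbb R^{\dim g}$ is compact and $|\ell|<4$ for all $\beta\in\Theta$. 4. For each $\beta\in\Theta$ the function $w\mapsto g((w,x,\mathbf z),\beta)$ is bounded and Lipschitz on the support of the data, with constants that do not depend on $n$, $i$, the network and $(x,\mathbf z)$. 5. There is $\bar L$ such that $\|g((w,x,\mathbf z),\beta)-g((w,x,\mathbf z),\beta')\|_2\le\bar L\|\beta-\beta'\|_2$ for all $\beta,\beta'\in\Theta$, all $n$, $i$ and all $(w,x,\mathbf z)$ in the support of the data. (In 4 and 5, the support of the data is the support of $(W_{n,i},X_{n,i},\mathbf Z)$ on the event that $A_n$ is the given network.) 6. The random matrices $\hat\Xi_n$ and $\Xi_n$ are a.s. positive definite, $\Xi_n$ is $\mathcal C_n$-measurable, $\sup_nE[\|\hat\Xi_n\|_F\mid\mathcal C_n]<\infty$ a.s., and $E[\|\hat\Xi_n-\Xi_n\|_F\mid\mathcal C_n]\to0$ a.s. 7. (Identification) $\beta_0\in\Theta$;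 $g_n(\beta_0)=0$ a.s. for all $n\ge1$; and for every $\epsilon>0$ there is an a.s. positive random variable $\kappa$ such that for each $\beta\in\Theta$ with $\|\beta-\beta_0\|_2\ge\epsilon$, a.s., $Q_n(\beta)\ge\kappa$ for all large $n$. *Conclusion.* For all $\epsilon>0$, $$P(\|\hat\beta_n-\beta_0\|_2>\epsilon\mid\mathcal C_n)\to0\quad\text{a.s. as }n\to\infty,$$ and $\hat\beta_n\to\beta_0$ in probability. -/

import Mathlib

open MeasureTheory ProbabilityTheory Filter Topology
open scoped ENNReal

noncomputable section

namespace NetworkGMM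

/-! ### Networks -/

/-- Entry `A_ij` of the adjacency matrix of an undirected network without self-loops. -/
def adj {n : ℕ} (G : SimpleGraph (Fin n)) (i j : Fin n) : ℝ :=
  open Classical in if G.Adj i j then 1 else 0

/-- Row-normalised adjacency matrix `A_ij / n_i`, where `n_i = ∑_j A_ij`
(a zero row for a node without neighbours). -/
def rowAdj {n : ℕ} (G : SimpleGraph (Fin n)) : Matrix (Fin n) (Fin n) ℝ :=
  fun i j => (∑ k, adj G i k)⁻¹ * adj G i j

/-- `N_A(i,s)`: the nodes at path distance at most `s` from `i`
(the distance between different components is infinite). -/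
def nbhd {n : ℕ} (G : SimpleGraph (Fin n)) (i : Fin n) (s : ℕ) : Finset (Fin n) :=
  open Classical in Finset.univ.filter fun j => G.edist i j ≤ (s : ℕ∞)

/-- `N_A^∂(i,s)`: the nodes at path distance exactly `s` from `i`. -/
def sphere {n : ℕ} (G : SimpleGraph (Fin n)) (i : Fin n) (s : ℕ) : Finset (Fin n) :=
  open Classical in Finset.univ.filter fun j => G.edist i j = (s : ℕ∞)

/-- `δ_n^∂(s) = n⁻¹ ∑_i |N_A^∂(i,s)|`. -/
def sphereAvg {n : ℕ} (G : SimpleGraph (Fin n)) (s : ℕ) : ℝ≥0∞ :=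
  (n : ℝ≥0∞)⁻¹ * ∑ i, ((sphere G i s).card : ℝ≥0∞)

/-- `max_i |N_A(i,s)|`. -/
def nbhdMax {n : ℕ} (G : SimpleGraph (Fin n)) (s : ℕ) : ℝ≥0∞ :=
  ⨆ i, ((nbhd G i s).card : ℝ≥0∞)

/-- Real value of a binary treatment. -/
def bval (b : Bool) : ℝ := if b then 1 else 0

/-- Replace by zero all entries outside `N_A(i,s)`: treatments. -/
def truncTreat {n : ℕ} (G : SimpleGraph (Fin n)) (i : Fin n) (s : ℕ) (d : Fin n → Bool) :
    Fin n → Bool :=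
  fun j => open Classical in if j ∈ nbhd G i s then d j else false

/-- Replace by zero all entries outside `N_A(i,s)`: shocks. -/
def truncShock {n : ℕ} (G : SimpleGraph (Fin n)) (i : Fin n) (s : ℕ) (v : Fin n → ℝ) :
    Fin n → ℝ :=
  fun j => open Classical in if j ∈ nbhd G i s then v j else 0

/-! ### Treatment choice -/

/-- Exogenous variables with the intercept `Z_{i0} = 1` added. -/
def withIntercept {kz : ℕ} (z : Fin kz → ℝ) : Fin (kz + 1) → ℝ := Fin.cons 1 z

/-- `Z_i' β_D + λ n_i⁻¹ ∑_j A_ij p_j`. -/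
def choiceIndex {n kz : ℕ} (G : SimpleGraph (Fin n)) (z : Fin n → Fin kz → ℝ)
    (bD : Fin (kz + 1) → ℝ) (lam : ℝ) (p : Fin n → ℝ) (i : Fin n) : ℝ :=
  (∑ k, withIntercept (z i) k * bD k) + lam * ∑ j, rowAdj G i j * p j

/-- `p` solves the equilibrium system with standard logistic private shocks
(`Real.sigmoid t = 1 / (1 + exp (-t))`). -/
def IsEquilibrium {n kz : ℕ} (G : SimpleGraph (Fin n)) (z : Fin n → Fin kz → ℝ)
    (bD : Fin (kz + 1) → ℝ) (lam : ℝ) (p : Fin n → ℝ) : Prop :=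
  ∀ i, p i = Real.sigmoid (choiceIndex G z bD lam p i)

/-- The vector of equilibrium choice probabilities `P(Z, A)` at the parameter `(β_D, λ)`: the
solution of the equilibrium system (it is unique if `|λ| < 4`). -/
def eqProb {n kz : ℕ} (G : SimpleGraph (Fin n)) (z : Fin n → Fin kz → ℝ)
    (bD : Fin (kz + 1) → ℝ) (lam : ℝ) : Fin n → ℝ :=
  open Classical in
  if h : ∃ p, IsEquilibrium G z bD lam p then h.choose else 0

/-- The treatment choices `D_i = 1{Z_i'β_D + λ n_i⁻¹ ∑_j A_ij P_j(Z,A) - ν_i ≥ 0}`. -/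
def treat {n kz : ℕ} (G : SimpleGraph (Fin n)) (z : Fin n → Fin kz → ℝ)
    (bD : Fin (kz + 1) → ℝ) (lam : ℝ) (v : Fin n → ℝ) : Fin n → Bool :=
  fun i => open Classical in
    decide (0 ≤ choiceIndex G z bD lam (eqProb G z bD lam) i - v i)

/-- The matrix `diag(1 / (P_i (1 - P_i))) - λ Ã`, with `Ã` the row-normalised adjacency matrix. -/
def scoreMatrix {n kz : ℕ} (G : SimpleGraph (Fin n)) (z : Fin n → Fin kz → ℝ)
    (bD : Fin (kz + 1) → ℝ) (lam : ℝ) : Matrix (Fin n) (Fin n) ℝ :=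
  Matrix.diagonal
    (fun i => 1 / (eqProb G z bD lam i * (1 - eqProb G z bD lam i))) - lam • rowAdj G

/-- `∂P/∂β_{Dk}`. -/
def dProbBD {n kz : ℕ} (G : SimpleGraph (Fin n)) (z : Fin n → Fin kz → ℝ)
    (bD : Fin (kz + 1) → ℝ) (lam : ℝ) (k : Fin (kz + 1)) : Fin n → ℝ :=
  ((scoreMatrix G z bD lam)⁻¹).mulVec fun i => withIntercept (z i) k

/-- `∂P/∂λ`. -/
def dProbLam {n kz : ℕ} (G : SimpleGraph (Fin n)) (z : Fin n → Fin kz → ℝ)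
    (bD : Fin (kz + 1) → ℝ) (lam : ℝ) : Fin n → ℝ :=
  ((scoreMatrix G z bD lam)⁻¹).mulVec ((rowAdj G).mulVec (eqProb G z bD lam))

/-! ### Parameters and moment functions -/

/-- Space of exposure levels `t = (t_1, t_2)`: coordinate `0` is the own treatment. -/
abbrev Expo (q : ℕ) : Type := EuclideanSpace ℝ (Fin (q + 1))

/-- Space of the points `w = (y, t, d)`. -/
abbrev WPoint (q : ℕ) : Type := ℝ × Expo q × ℝ

/-- Euclidean distance of two points `(y, t, d)`. -/
def wDist {q : ℕ} (w w' : WPoint q) : ℝ :=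
  Real.sqrt (|w.1 - w'.1| ^ 2 + ‖w.2.1 - w'.2.1‖ ^ 2 + |w.2.2 - w'.2.2| ^ 2)

/-- Coordinates of `β = (β_D, λ, β_X^{(t)}, β_p^{(t)}, β_X^{(t')}, β_p^{(t')})`. -/
abbrev PIdx (kz kx : ℕ) : Type :=
  (Fin (kz + 1) ⊕ Unit) ⊕ ((Fin kx ⊕ Unit) ⊕ (Fin kx ⊕ Unit))

abbrev Param (kz kx : ℕ) : Type := EuclideanSpace ℝ (PIdx kz kx)

def paramD {kz kx : ℕ} (β : Param kz kx) (k : Fin (kz + 1)) : ℝ := β (Sum.inl (Sum.inl k))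

def paramLam {kz kx : ℕ} (β : Param kz kx) : ℝ := β (Sum.inl (Sum.inr ()))

/-- `(1 + P)` replaces `P` in the second-stage moments if `t_1 = 0`. -/
def control {q : ℕ} (t : Expo q) (p : ℝ) : ℝ :=
  open Classical in if t 0 = 1 then p else 1 + p

/-- The second-stage moments `(g^{β_X^{(t)}}, g^{β_p^{(t)}})` for the exposure level `t` at the
coefficients `b = (β_X^{(t)}, β_p^{(t)})`; `p` is the choice probability of the node. -/
def secondStage {kx q : ℕ} (t : Expo q) (p : ℝ) (w : WPoint q) (x : Fin kx → ℝ)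
    (b : Fin kx ⊕ Unit → ℝ) : Fin kx ⊕ Unit → ℝ :=
  open Classical in
  let resid : ℝ := w.1 - (∑ k, x k * b (Sum.inl k)) - control t p / 2 * b (Sum.inr ())
  Sum.elim (fun k => (if w.2.1 = t then 1 else 0) * (2 * x k) * resid)
    (fun _ => (if w.2.1 = t then 1 else 0) * control t p * resid)

/-- The moment function `g((w, x, z), β)` of node `i` in the network `G`, for a comparison of the
exposure levels `t` and `t'`. -/
def moment {n kz kx q : ℕ} (t t' : Expo q) (G : SimpleGraph (Fin n)) (i : Fin n)
    (w : WPoint q) (x : Fin kx → ℝ) (z : Fin n → Fin kz → ℝ) (β : Param kz kx) : Param kz kx :=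
  let bD := paramD β
  let lam := paramLam β
  let P := eqProb G z bD lam
  WithLp.toLp 2 <|
    Sum.elim
      (Sum.elim
        (fun k => (w.2.2 - P i) *
          (withIntercept (z i) k + lam * ∑ j, rowAdj G i j * dProbBD G z bD lam k j))
        (fun _ => (w.2.2 - P i) *
          ((∑ j, rowAdj G i j * P j) + lam * ∑ j, rowAdj G i j * dProbLam G z bD lam j)))
      (Sum.elim
        (secondStage t (P i) w x fun a => β (Sum.inr (Sum.inl a)))
        (secondStage t' (P i) w x fun a => β (Sum.inr (Sum.inr a))))

/-- `v' M v`. -/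
def quad {ι : Type*} [Fintype ι] (M : Matrix ι ι ℝ) (v : EuclideanSpace ℝ ι) : ℝ :=
  ∑ a, ∑ b, v a * M a b * v b

/-- Frobenius norm `√ trace(M'M)`. -/
def frob {ι : Type*} [Fintype ι] (M : Matrix ι ι ℝ) : ℝ :=
  Real.sqrt (M.transpose * M).trace

/-! ### The triangular array -/

/-- The primitives of the model. Row `n` has the nodes `Fin n`. -/
structure NetworkModel (Ω : Type*) (kz kx q : ℕ) where
  /-- common shocks -/
  C : ℕ → MeasurableSpace Ω
  /-- network -/
  A : (n : ℕ) → Ω → SimpleGraph (Fin n)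
  /-- covariates -/
  X : (n : ℕ) → Fin n → Ω → Fin kx → ℝ
  /-- exogenous variables of the treatment choice -/
  Z : (n : ℕ) → Fin n → Ω → Fin kz → ℝ
  /-- private shocks of the treatment choice -/
  ν : (n : ℕ) → Fin n → Ω → ℝ
  /-- outcome errors `e_i^{(t)}` -/
  e : (n : ℕ) → Fin n → Ω → Expo q → ℝ
  /-- exposure mapping `T(i, d, A)` -/
  expo : (n : ℕ) → SimpleGraph (Fin n) → Fin n → (Fin n → Bool) → Expo q
  /-- true coefficients: `β_D`, `λ`, `β_X^{(t)}`, `β_p^{(t)}` -/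
  bD : Fin (kz + 1) → ℝ
  lam : ℝ
  bX : Expo q → Fin kx → ℝ
  bp : Expo q → ℝ

/-- Independence, conditionally on `m`, of a finite family of random elements. -/
def CondIndepFamily {Ω : Type*} (m : MeasurableSpace Ω) [MeasurableSpace Ω] (μ : Measure Ω)
    {ι E : Type*} [Fintype ι] [MeasurableSpace E] (ξ : ι → Ω → E) : Prop :=
  ∀ B : ι → Set E, (∀ i, MeasurableSet (B i)) →
    μ⟦⋂ i, ξ i ⁻¹' B i | m⟧ =ᵐ[μ] fun ω => ∏ i, (μ⟦ξ i ⁻¹' B i | m⟧) ω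

namespace NetworkModel

variable {Ω : Type*} {kz kx q : ℕ} (M : NetworkModel Ω kz kx q)

/-- The matrix `𝐙` of row `n`. -/
def Zmat (n : ℕ) (ω : Ω) : Fin n → Fin kz → ℝ := fun i => M.Z n i ω

/-- Treatments `𝐃_n`. -/
def D (n : ℕ) (ω : Ω) : Fin n → Bool :=
  treat (M.A n ω) (M.Zmat n ω) M.bD M.lam fun j => M.ν n j ω

/-- `D_{n,i}^{(s)}`: the treatment of `i` with the shocks outside `N(i,s)` set to zero. -/
def DTrunc (n : ℕ) (i : Fin n) (s : ℕ) (ω : Ω) : Bool :=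
  treat (M.A n ω) (M.Zmat n ω) M.bD M.lam
    (truncShock (M.A n ω) i s fun j => M.ν n j ω) i

/-- Exposure of node `i` under the treatment vector `d`. -/
def TPot (n : ℕ) (i : Fin n) (d : Fin n → Bool) (ω : Ω) : Expo q := M.expo n (M.A n ω) i d

/-- Outcome of node `i` under the treatment vector `d`:
`Y_i = X_i'β_X^{(t)} + V_i β_p^{(t)} + e_i^{(t)}` with `t = T_i(d)` and `V_i = F(ν_i)`. -/
def YPot (n : ℕ) (i : Fin n) (d : Fin n → Bool) (ω : Ω) : ℝ :=
  (∑ k, M.X n i ω k * M.bX (M.TPot n i d ω) k)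
    + Real.sigmoid (M.ν n i ω) * M.bp (M.TPot n i d ω) + M.e n i ω (M.TPot n i d ω)

/-- Observed exposure `T_{n,i}`. -/
def T (n : ℕ) (i : Fin n) (ω : Ω) : Expo q := M.TPot n i (M.D n ω) ω

/-- Observed outcome `Y_{n,i}`. -/
def Y (n : ℕ) (i : Fin n) (ω : Ω) : ℝ := M.YPot n i (M.D n ω) ω

/-- `T_{n,i}^{(s)}`: exposure with the treatments outside `N(i,s)` set to zero. -/
def TTrunc (n : ℕ) (i : Fin n) (s : ℕ) (ω : Ω) : Expo q :=
  M.TPot n i (truncTreat (M.A n ω) i s (M.D n ω)) ω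

/-- `Y_{n,i}^{(s)}`: outcome with the treatments outside `N(i,s)` set to zero. -/
def YTrunc (n : ℕ) (i : Fin n) (s : ℕ) (ω : Ω) : ℝ :=
  M.YPot n i (truncTreat (M.A n ω) i s (M.D n ω)) ω

/-- `W_{n,i} = (Y_{n,i}, T_{n,i}, D_{n,i})`. -/
def W (n : ℕ) (i : Fin n) (ω : Ω) : WPoint q := (M.Y n i ω, M.T n i ω, bval (M.D n ω i))

/-- The true parameter `β_0` for the exposure levels `t`, `t'`. -/
def trueParam (t t' : Expo q) : Param kz kx :=
  WithLp.toLp 2 <|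
    Sum.elim (Sum.elim M.bD fun _ => M.lam)
      (Sum.elim (Sum.elim (M.bX t) fun _ => M.bp t) (Sum.elim (M.bX t') fun _ => M.bp t'))

/-- `g((W_{n,i}, X_{n,i}, 𝐙), β)`. -/
def g (t t' : Expo q) (n : ℕ) (i : Fin n) (β : Param kz kx) (ω : Ω) : Param kz kx :=
  moment t t' (M.A n ω) i (M.W n i ω) (M.X n i ω) (M.Zmat n ω) β

/-- Sample moments `ĝ_n(β)`. -/
def gHat (t t' : Expo q) (n : ℕ) (β : Param kz kx) (ω : Ω) : Param kz kx :=
  (n : ℝ)⁻¹ • ∑ i, M.g t t' n i β ω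

/-- Sample objective function `Q̂_n(β) = ĝ_n(β)' Ξ̂_n ĝ_n(β)`. -/
def QHat (t t' : Expo q) (Xihat : ℕ → Ω → Matrix (PIdx kz kx) (PIdx kz kx) ℝ)
    (n : ℕ) (β : Param kz kx) (ω : Ω) : ℝ :=
  quad (Xihat n ω) (M.gHat t t' n β ω)

section Probability

variable [MeasurableSpace Ω] (μ : Measure Ω)

/-- Population moments given the common shocks, `g_n(β) = n⁻¹ ∑_i E[g((W_{n,i},X_{n,i},𝐙),β) | C_n]`
(the nodes need not be identically distributed given `C_n`). -/
def gPop (t t' : Expo q) (n : ℕ) (β : Param kz kx) (ω : Ω) : Param kz kx :=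
  (n : ℝ)⁻¹ • ∑ i, (μ[M.g t t' n i β | M.C n]) ω

/-- Population objective function `Q_n(β) = g_n(β)' Ξ_n g_n(β)`. -/
def QPop (t t' : Expo q) (Xi : ℕ → Ω → Matrix (PIdx kz kx) (PIdx kz kx) ℝ)
    (n : ℕ) (β : Param kz kx) (ω : Ω) : ℝ :=
  quad (Xi n ω) (M.gPop μ t t' n β ω)

/-- `θ_{n,s}^D = 2 max_i E[|D_i - D_i^{(s)}| | C_n]`. Conditional expectations of nonnegative
variables take values in `[0, ∞]`. -/
def thetaD (n s : ℕ) (ω : Ω) : ℝ≥0∞ :=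
  2 * ⨆ i, condLExp (M.C n) μ
    (fun ω' => ENNReal.ofReal |bval (M.D n ω' i) - bval (M.DTrunc n i s ω')|) ω

/-- `θ_{n,s}^W = 2 (max_i E[|Y_i - Y_i^{(s)}| | C_n] + max_i E[‖T_i - T_i^{(s)}‖ | C_n])
+ max_i |N(i,s)| θ_{n,s}^D`. -/
def thetaW (n s : ℕ) (ω : Ω) : ℝ≥0∞ :=
  2 * ((⨆ i, condLExp (M.C n) μ
          (fun ω' => ENNReal.ofReal |M.Y n i ω' - M.YTrunc n i s ω'|) ω)
      + ⨆ i, condLExp (M.C n) μ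
          (fun ω' => ENNReal.ofReal ‖M.T n i ω' - M.TTrunc n i s ω'‖) ω)
    + nbhdMax (M.A n ω) s * M.thetaD μ n s ω

/-- Dependence coefficient for node sets at distance at least `s ≥ 1`. The number `θ_{n,r}^W`
controls conditional covariances across a distance of at least `4r + 1`, so that the coefficient
at distance `s` is `θ_{n,r}^W` with `r` the largest number such that `4r + 1 ≤ s`. -/
def psiCoeff (n s : ℕ) (ω : Ω) : ℝ≥0∞ := M.thetaW μ n ((s - 1) / 4) ω

/-- Support of `(W_{n,i}, X_{n,i}, 𝐙)` on the event that the network of row `n` is `G`. -/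
def dataSupport (n : ℕ) (i : Fin n) (G : SimpleGraph (Fin n)) :
    Set (WPoint q × (Fin kx → ℝ) × (Fin n → Fin kz → ℝ)) :=
  ((μ.restrict {ω | M.A n ω = G}).map
    fun ω => (M.W n i ω, M.X n i ω, M.Zmat n ω)).support

/-- Measurability: the common shocks `C_n` determine the network, the covariates and the
exogenous variables. -/
structure IsMeasurable : Prop where
  le : ∀ n, M.C n ≤ ‹MeasurableSpace Ω›
  network : ∀ n i j, MeasurableSet[M.C n] {ω | (M.A n ω).Adj i j}
  covariates : ∀ n i, Measurable[M.C n] (M.X n i)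
  exogenous : ∀ n i, Measurable[M.C n] (M.Z n i)
  shocks : ∀ n i, Measurable (M.ν n i)
  errors : ∀ n i, Measurable (M.e n i)

/-- Conditionally on the common shocks, the pairs of a private shock and outcome errors are
independent across the nodes, and the private shocks are standard logistic. -/
structure ShockAssumption : Prop where
  indep : ∀ n, CondIndepFamily (M.C n) μ fun i ω => (M.ν n i ω, M.e n i ω)
  logistic : ∀ n i x, μ⟦M.ν n i ⁻¹' Set.Iic x | M.C n⟧ =ᵐ[μ] fun _ => Real.sigmoid x

/-- `T_i(d) = (d_i, f_i(d_j : j ∈ N(i,K), j ≠ i))` for a function `f_i`, given the network, that is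
invariant under permutations of the `K`-neighbours of `i`. -/
structure ExposureAssumption (K : ℕ) : Prop where
  own : ∀ n G i d, M.expo n G i d 0 = bval (d i)
  isLocal : ∀ n G i d d', (∀ j ∈ nbhd G i K, d j = d' j) → M.expo n G i d = M.expo n G i d'
  anonymous : ∀ n G i d (π : Equiv.Perm (Fin n)), π i = i → (∀ j ∉ nbhd G i K, π j = j) →
    M.expo n G i (d ∘ π) = M.expo n G i d

/-- The regularity conditions of the law of large numbers. -/
structure RegularityLLN (t t' : Expo q) (Θ : Set (Param kz kx)) : Prop where
  /-- conditional moments of order `1 + ε` -/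
  moments : ∃ ε : ℝ, 0 < ε ∧ ∀ n i, ∀ᵐ ω ∂μ, condLExp (M.C n) μ
    (fun ω' => ENNReal.ofReal (|M.Y n i ω'| ^ (1 + ε) + (∑ r, |M.T n i ω' r| ^ (1 + ε))
      + |bval (M.D n ω' i)| ^ (1 + ε))) ω < ∞
  /-- network dependence; finite path distances in row `n` are smaller than `n` -/
  decay : ∀ᵐ ω ∂μ, Tendsto
    (fun n : ℕ => (n : ℝ≥0∞)⁻¹ *
      ∑ s ∈ Finset.Icc 1 n, sphereAvg (M.A n ω) s * M.psiCoeff μ n s ω) atTop (𝓝 0)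
  /-- compact parameter space, on which the equilibrium is unique -/
  compact : IsCompact Θ
  peer : ∀ β ∈ Θ, |paramLam β| < 4
  /-- bounded Lipschitz moments on the support -/
  boundedLipschitz : ∀ β ∈ Θ, ∃ B L : ℝ, ∀ n i G x z w, (w, x, z) ∈ M.dataSupport μ n i G →
    ‖moment t t' G i w x z β‖ ≤ B ∧
    ∀ w', (w', x, z) ∈ M.dataSupport μ n i G →
      ‖moment t t' G i w x z β - moment t t' G i w' x z β‖ ≤ L * wDist w w'
  /-- uniform equicontinuity on the support -/
  equicontinuous : ∃ L : ℝ, 0 < L ∧ ∀ n i G x z w, (w, x, z) ∈ M.dataSupport μ n i G →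
    ∀ β ∈ Θ, ∀ β' ∈ Θ,
      ‖moment t t' G i w x z β - moment t t' G i w x z β'‖ ≤ L * ‖β - β'‖

/-- The weight matrices `Ξ̂_n` and their `C_n`-measurable counterparts `Ξ_n`. -/
structure WeightAssumption (Xihat Xi : ℕ → Ω → Matrix (PIdx kz kx) (PIdx kz kx) ℝ) : Prop where
  measurable_hat : ∀ n a b, Measurable fun ω => Xihat n ω a b
  posDef_hat : ∀ n, 1 ≤ n → ∀ᵐ ω ∂μ, (Xihat n ω).PosDef
  measurable_pop : ∀ n a b, Measurable[M.C n] fun ω => Xi n ω a b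
  posDef_pop : ∀ n, 1 ≤ n → ∀ᵐ ω ∂μ, (Xi n ω).PosDef
  bounded : ∀ᵐ ω ∂μ,
    (⨆ n : ℕ, ⨆ _ : 1 ≤ n, condLExp (M.C n) μ (fun ω' => ENNReal.ofReal (frob (Xihat n ω'))) ω) < ∞
  tendsto : ∀ᵐ ω ∂μ, Tendsto
    (fun n => condLExp (M.C n) μ (fun ω' => ENNReal.ofReal (frob (Xihat n ω' - Xi n ω'))) ω)
    atTop (𝓝 0)

/-- `β_0 ∈ Θ` solves the population moment equations in every row and is, asymptotically, the
well-separated minimiser of the population objective function on `Θ`: outside each ball around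
`β_0`, the functions `Q_n` stay above a positive (random) level for all large `n`. -/
structure IsIdentified (t t' : Expo q) (Θ : Set (Param kz kx))
    (Xi : ℕ → Ω → Matrix (PIdx kz kx) (PIdx kz kx) ℝ) (β₀ : Param kz kx) : Prop where
  mem : β₀ ∈ Θ
  moment_eq_zero : ∀ n, 1 ≤ n → ∀ᵐ ω ∂μ, M.gPop μ t t' n β₀ ω = 0
  separated : ∀ ε : ℝ, 0 < ε → ∃ κ : Ω → ℝ, (∀ᵐ ω ∂μ, 0 < κ ω) ∧
    ∀ β ∈ Θ, ε ≤ ‖β - β₀‖ → ∀ᵐ ω ∂μ, ∀ᶠ n in atTop, κ ω ≤ M.QPop μ t t' Xi n β ω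

end Probability

end NetworkModel

end NetworkGMM

end

noncomputable section

namespace NetworkGMM

/-! The proof combines a law of large numbers given `C n`, at each fixed parameter, with a finite
covering of the parameters away from the truth.

Law of large numbers. Given the common shocks, the network and the equilibrium probabilities are
fixed, so a treatment depends only on the node's own shock. Under the regular conditional
distribution `shockKernel` the node shocks are independent (`iIndepFun_condDistrib`), and `W` with
the treatments outside `N(i,r)` set to zero is a function of the shocks in `N(i,r)`. For nodes at
distance greater than `2r` these neighbourhoods are disjoint, so the covariance of two moments is at
most a constant times the truncation error. Summing over pairs bounds the conditional variance of a
sample moment by a multiple of `1/n` plus the network dependence term that tends to zero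
(`ofReal_variance_average_le`, `tendsto_condLExp_norm_gHat_sub_gPop`).

Consistency. Suppose the estimator lies within `d` of a fixed `β`. Lipschitz continuity of the
moments in the parameter, together with minimality compared with `β₀`, bounds `Q_n(β) - 2BLd‖Ξ_n‖`
by the deviations of the sample moments at `β` and `β₀` and by `‖Ξ̂_n - Ξ_n‖`
(`quad_le_of_quad_le`). The left side is `C n`-measurable, so it factors out of the conditional
expectation of this inequality on the event. Hence the conditional probability of the event vanishes
wherever the left side stays above a positive level (`ae_tendsto_condLExp_near`). Finitely many such
balls cover the part of `Θ` outside a ball around `β₀` (`ae_tendsto_condLExp_far`), so no uniform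
law of large numbers is needed. The separation level and the bound on `Ξ_n` are random, so the
radius is chosen for each `ω` from a countable family. Dominated convergence then gives the
unconditional statement. -/

/-! ### Conditional Lebesgue expectations -/

section CondLExp

variable {Ω : Type*} {m m₀ : MeasurableSpace Ω} {μ : Measure[m₀] Ω}

/-- Factors measurable with respect to the conditioning `σ`-algebra can be pulled out of a
conditional Lebesgue expectation. -/
theorem condLExp_mul_of_measurable_left (hm : m ≤ m₀) [IsFiniteMeasure μ] {f g : Ω → ℝ≥0∞}
    (hf : Measurable[m] f) (hg : Measurable[m₀] g) :
    condLExp m μ (fun ω => f ω * g ω) =ᵐ[μ] fun ω => f ω * condLExp m μ g ω := by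
  refine (ae_eq_condLExp hm μ _ (hf.mul (measurable_condLExp m μ g)) fun s hs => ?_).symm
  -- Monotone class argument in `f`. The indicator case replaces `s` by `t ∩ s`, so the identity
  -- must be proved for all `s` at once.
  revert s
  refine Measurable.ennreal_induction (motive := fun f => ∀ s, MeasurableSet[m] s →
    ∫⁻ ω in s, f ω * condLExp m μ g ω ∂μ = ∫⁻ ω in s, f ω * g ω ∂μ)
    (fun c t ht s hs => ?_) (fun f₁ f₂ _ hf₁ _ h₁ h₂ s hs => ?_) (fun f hf hmono h s hs => ?_) hf
  · have h1 : ∀ h : Ω → ℝ≥0∞, (fun ω => t.indicator (fun _ => c) ω * h ω)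
        = t.indicator fun ω => c * h ω := by
      intro h; ext ω; by_cases hω : ω ∈ t <;> simp [hω]
    simp only [h1]
    rw [setLIntegral_indicator (hm t ht), setLIntegral_indicator (hm t ht),
      lintegral_const_mul _ (measurable_condLExp' m μ g), lintegral_const_mul _ hg,
      setLIntegral_condLExp hm μ g (ht.inter hs)]
  · simp only [Pi.add_apply, add_mul]
    have hf₁' := hf₁.mono hm le_rfl
    rw [lintegral_add_left (hf₁'.fun_mul (measurable_condLExp' m μ g)),
      lintegral_add_left (hf₁'.fun_mul hg), h₁ s hs, h₂ s hs]
  · have hf' := fun k => (hf k).mono hm le_rfl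
    simp only [ENNReal.iSup_mul]
    rw [lintegral_iSup (fun k => (hf' k).fun_mul (measurable_condLExp' m μ g))
        (fun a b hab ω => mul_le_mul_left (hmono hab ω) _),
      lintegral_iSup (fun k => (hf' k).fun_mul hg)
        (fun a b hab ω => mul_le_mul_left (hmono hab ω) _)]
    exact iSup_congr fun k => h k s hs

/-- The conditional probability of an event as a conditional Lebesgue expectation. -/
theorem ofReal_condExp_indicator (hm : m ≤ m₀) [IsFiniteMeasure μ] {s : Set Ω}
    (hs : MeasurableSet[m₀] s) :
    (fun ω => ENNReal.ofReal ((μ⟦s | m⟧) ω)) =ᵐ[μ] condLExp m μ (s.indicator fun _ => 1) := by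
  have h_int : Integrable (s.indicator fun _ => (1 : ℝ)) μ := (integrable_const _).indicator hs
  refine ae_eq_condLExp hm μ _ (stronglyMeasurable_condExp.measurable.ennreal_ofReal)
    fun t ht => ?_
  rw [← ofReal_integral_eq_lintegral_ofReal integrable_condExp.restrict
      (ae_restrict_of_ae (condExp_nonneg (ae_of_all _ fun ω => Set.indicator_nonneg
        (fun _ _ => zero_le_one) ω))), setIntegral_condExp hm h_int ht,
    ofReal_integral_eq_lintegral_ofReal h_int.restrict (ae_of_all _ fun ω => Set.indicator_nonneg
        (fun _ _ => zero_le_one) ω)]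
  refine lintegral_congr fun ω => ?_
  by_cases hω : ω ∈ s <;> simp [hω]

end CondLExp

/-! ### Regular conditional distributions -/

section CondDistrib

variable {Ω β E : Type*} [MeasurableSpace Ω] [mβ : MeasurableSpace β] [MeasurableSpace E]
  [StandardBorelSpace E] [Nonempty E] {μ : Measure Ω} [IsFiniteMeasure μ]
  {X : Ω → β} {U : Ω → E}

/-- Disintegration: the joint law of `(X, U)` is the law of `X` composed with the kernel.
Integrating over `t ×ˢ univ` tests the candidate on the sets `X ⁻¹' t`, which are all the sets of
the conditioning `σ`-algebra. -/
theorem condLExp_ae_eq_lintegral_condDistrib (hX : Measurable X) (hU : Measurable U)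
    {F : β × E → ℝ≥0∞} (hF : Measurable F) :
    condLExp (mβ.comap X) μ (fun ω => F (X ω, U ω)) =ᵐ[μ]
      fun ω => ∫⁻ u, F (X ω, u) ∂condDistrib U X μ (X ω) := by
  have hG : Measurable fun b => ∫⁻ u, F (b, u) ∂condDistrib U X μ b :=
    hF.lintegral_kernel_prod_right'
  refine (ae_eq_condLExp hX.comap_le μ _ (hG.comp (comap_measurable X)) ?_).symm
  rintro _ ⟨t, ht, rfl⟩
  have h1 : ∫⁻ ω in X ⁻¹' t, ∫⁻ u, F (X ω, u) ∂condDistrib U X μ (X ω) ∂μ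
      = ∫⁻ b in t, ∫⁻ u, F (b, u) ∂condDistrib U X μ b ∂(μ.map X) := by
    rw [setLIntegral_map ht hG hX]
  have h2 : ∫⁻ p in t ×ˢ Set.univ, F p ∂(μ.map X ⊗ₘ condDistrib U X μ)
      = ∫⁻ b in t, ∫⁻ u, F (b, u) ∂condDistrib U X μ b ∂(μ.map X) := by
    rw [Measure.setLIntegral_compProd hF ht MeasurableSet.univ]
    simp
  change ∫⁻ ω in X ⁻¹' t, ∫⁻ u, F (X ω, u) ∂condDistrib U X μ (X ω) ∂μ = _
  rw [h1, ← h2, compProd_map_condDistrib hU.aemeasurable,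
    setLIntegral_map (ht.prod MeasurableSet.univ) hF (hX.prodMk hU)]
  simp [Set.mk_preimage_prod]

theorem ae_ae_condDistrib (hX : Measurable X) (hU : Measurable U) {p : β × E → Prop}
    (hp : MeasurableSet {x | p x}) (h : ∀ᵐ ω ∂μ, p (X ω, U ω)) :
    ∀ᵐ ω ∂μ, ∀ᵐ u ∂condDistrib U X μ (X ω), p (X ω, u) := by
  refine ae_of_ae_map hX.aemeasurable (p := fun b => ∀ᵐ u ∂condDistrib U X μ b, p (b, u)) ?_
  apply Measure.ae_ae_of_ae_compProd
  rw [compProd_map_condDistrib hU.aemeasurable, ae_map_iff (hX.prodMk hU).aemeasurable hp]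
  exact h

end CondDistrib

/-- A conditionally independent family has, almost surely, independent coordinates under its
regular conditional distribution. -/
theorem iIndepFun_condDistrib {Ω β E ι : Type*} [MeasurableSpace Ω] [mβ : MeasurableSpace β]
    [MeasurableSpace E] [StandardBorelSpace E] [Nonempty E] [Fintype ι] {μ : Measure Ω}
    [IsFiniteMeasure μ] {X : Ω → β} {U : Ω → ι → E} (hX : Measurable X) (hU : Measurable U)
    (h : CondIndepFamily (mβ.comap X) μ fun i ω => U ω i) :
    ∀ᵐ ω ∂μ, iIndepFun (fun (i : ι) (u : ι → E) => u i) (condDistrib U X μ (X ω)) := by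
  classical
  -- Conditional independence gives one null set per family of events, so only countably many events
  -- may be tested. A countable generating algebra suffices: it is closed under intersections, as a
  -- π-system must be, and contains `univ`, which fills in the coordinates outside a finite
  -- subfamily.
  set S : Set (Set E) := generateSetAlgebra (MeasurableSpace.countableGeneratingSet E) with hSdef
  have hSc : S.Countable :=
    countable_generateSetAlgebra (MeasurableSpace.countable_countableGeneratingSet)
  have hSgen : MeasurableSpace.generateFrom S = ‹MeasurableSpace E› := by
    rw [hSdef, generateFrom_generateSetAlgebra_eq,
      MeasurableSpace.generateFrom_countableGeneratingSet]
  have hSalg : IsSetAlgebra S := isSetAlgebra_generateSetAlgebra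
  have hSmeas : ∀ s ∈ S, MeasurableSet s := fun s hs =>
    hSgen ▸ MeasurableSpace.measurableSet_generateFrom hs
  have : Countable S := hSc.to_subtype
  have huniv : Set.univ ∈ S := hSalg.univ_mem
  have key : ∀ B : ι → S, ∀ᵐ ω ∂μ,
      (condDistrib U X μ (X ω)).real (⋂ i, (fun u : ι → E => u i) ⁻¹' (B i : Set E)) =
        ∏ i, (condDistrib U X μ (X ω)).real ((fun u : ι → E => u i) ⁻¹' (B i : Set E)) := by
    intro B
    have hB : ∀ i, MeasurableSet ((fun u : ι → E => u i) ⁻¹' (B i : Set E)) := fun i =>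
      measurable_pi_apply i (hSmeas _ (B i).2)
    have h1 := condDistrib_ae_eq_condExp (μ := μ) hX hU (MeasurableSet.iInter hB)
    have h2 : ∀ᵐ ω ∂μ, ∀ i, _ := ae_all_iff.2 fun i =>
      condDistrib_ae_eq_condExp (μ := μ) hX hU (hB i)
    filter_upwards [h1, h2, h (fun i => B i) fun i => hSmeas _ (B i).2] with ω h1 h2 h3
    rw [h1, Finset.prod_congr rfl fun i _ => h2 i]
    rw [Set.preimage_iInter]
    exact h3
  filter_upwards [ae_all_iff.2 key] with ω hω
  set ρ := condDistrib U X μ (X ω)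
  rw [iIndepFun_iff_iIndep]
  refine iIndepSets.iIndep (fun i => (measurable_pi_apply i).comap_le)
    (fun i => (Set.preimage fun u : ι → E => u i) '' S) (fun i => ?_) (fun i => ?_) ?_
  · rintro _ ⟨s, hs, rfl⟩ _ ⟨t, ht, rfl⟩ _
    exact ⟨s ∩ t, hSalg.inter_mem hs ht, rfl⟩
  · rw [← hSgen, MeasurableSpace.comap_generateFrom]
  · rw [iIndepSets_iff]
    intro T f hf
    choose! b hbS hb using hf
    set B : ι → S := fun i => if h : i ∈ T then ⟨b i, hbS i h⟩ else ⟨Set.univ, huniv⟩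
    have hBin : ∀ i ∈ T, (fun u : ι → E => u i) ⁻¹' (B i : Set E) = f i := by
      intro i hi; simp only [B, hi, dite_true]; exact hb i hi
    have hBout : ∀ i ∉ T, (fun u : ι → E => u i) ⁻¹' (B i : Set E) = Set.univ := by
      intro i hi; simp [B, hi]
    have hinter : ⋂ i ∈ T, f i = ⋂ i, (fun u : ι → E => u i) ⁻¹' (B i : Set E) := by
      ext u
      simp only [Set.mem_iInter]
      refine ⟨fun hu i => ?_, fun hu i hi => hBin i hi ▸ hu i⟩
      by_cases hi : i ∈ T
      · rw [hBin i hi]; exact hu i hi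
      · rw [hBout i hi]; trivial
    have hprod : ∏ i ∈ T, ρ.real (f i)
        = ∏ i, ρ.real ((fun u : ι → E => u i) ⁻¹' (B i : Set E)) := by
      rw [← Finset.prod_subset (Finset.subset_univ T) fun i _ hi => by
        rw [hBout i hi]; simp]
      exact Finset.prod_congr rfl fun i hi => by rw [hBin i hi]
    have := hω B
    rw [← hinter, ← hprod] at this
    rw [← ENNReal.ofReal_toReal (measure_ne_top ρ _), ← measureReal_def, this,
      ENNReal.ofReal_prod_of_nonneg fun i _ => measureReal_nonneg]
    simp

/-! ### Covariances of approximately local functions -/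

section Covariance

/-- Centring `g` alone is enough: `cov[h, g] = E[h (g - E g)]`, and `|g - E g| ≤ 2B`. The bound is
linear in the mean of `|h|`, which is how truncation errors are measured. -/
theorem abs_covariance_le_of_bounded {Ω : Type*} [MeasurableSpace Ω] {ρ : Measure Ω}
    [IsProbabilityMeasure ρ] {h g : Ω → ℝ} {B : ℝ} (hh : Integrable h ρ) (hg : Measurable g)
    (hgB : ∀ ω, |g ω| ≤ B) : |cov[h, g; ρ]| ≤ 2 * B * ∫ ω, |h ω| ∂ρ := by
  have hgi : Integrable g ρ := Integrable.of_bound hg.aestronglyMeasurable B (ae_of_all _ hgB)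
  have hgE : |∫ ω, g ω ∂ρ| ≤ B := by
    have := norm_integral_le_of_norm_le_const (μ := ρ) (f := g) (ae_of_all _ hgB)
    simpa using this
  have hgc : ∀ ω, |g ω - ∫ x, g x ∂ρ| ≤ 2 * B := fun ω =>
    (abs_sub _ _).trans (by linarith [hgB ω])
  have e1 : cov[h, g; ρ] = ∫ ω, h ω * (g ω - ∫ x, g x ∂ρ) ∂ρ := by
    have h_int : Integrable (fun ω => h ω * (g ω - ∫ x, g x ∂ρ)) ρ := by
      refine hh.mul_bdd (c := 2 * B) (by fun_prop) (ae_of_all _ hgc)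
    rw [covariance]
    simp only [sub_mul]
    have hgi' : Integrable (fun ω => g ω - ∫ x, g x ∂ρ) ρ := hgi.sub (integrable_const _)
    rw [integral_sub h_int (hgi'.const_mul _), integral_const_mul,
      integral_sub hgi (integrable_const _)]
    simp
  rw [e1]
  refine (abs_integral_le_integral_abs).trans ?_
  rw [← integral_const_mul]
  refine integral_mono_of_nonneg (ae_of_all _ fun _ => abs_nonneg _) (hh.abs.const_mul _)
    (ae_of_all _ fun ω => ?_)
  simp only [abs_mul]
  nlinarith [hgc ω, abs_nonneg (h ω)]

variable {ι E : Type*} [MeasurableSpace E]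

/-- Freezing the coordinates outside `S` at an arbitrary point gives the factor; independence of
blocks of coordinates applies to functions in this form. -/
theorem DependsOn.exists_measurable_factor [Nonempty E] {f : (ι → E) → ℝ} {S : Finset ι}
    (hf : Measurable f) (hS : DependsOn f (S : Set ι)) :
    ∃ F : (S → E) → ℝ, Measurable F ∧ ∀ u, f u = F fun i => u i := by
  classical
  let c : E := Classical.arbitrary E
  refine ⟨fun v => f fun i => if h : i ∈ S then v ⟨i, h⟩ else c, hf.comp ?_, fun u => hS ?_⟩
  · refine measurable_pi_lambda _ fun i => ?_
    by_cases h : i ∈ S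
    · simpa [h] using measurable_pi_apply (⟨i, h⟩ : S)
    · simp [h]
  · intro i hi
    have : i ∈ S := hi
    simp [this]

/-- Covariance of two functions that are close to functions of disjoint sets of independent
coordinates. -/
theorem ofReal_abs_covariance_le [Nonempty E] {ρ : Measure (ι → E)} [IsProbabilityMeasure ρ]
    (hρ : iIndepFun (fun (i : ι) (u : ι → E) => u i) ρ) {S T : Finset ι} (hST : Disjoint S T)
    {f f' g g' : (ι → E) → ℝ} {B : ℝ} (hf : Measurable f) (hf' : Measurable f')
    (hg : Measurable g) (hg' : Measurable g') (hfB : ∀ u, |f u| ≤ B) (hf'B : ∀ u, |f' u| ≤ B)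
    (hgB : ∀ u, |g u| ≤ B) (hg'B : ∀ u, |g' u| ≤ B)
    (hS : DependsOn f' (S : Set ι)) (hT : DependsOn g' (T : Set ι)) :
    ENNReal.ofReal |cov[f, g; ρ]| ≤ ENNReal.ofReal (2 * B) *
      ((∫⁻ u, ENNReal.ofReal |f u - f' u| ∂ρ) + ∫⁻ u, ENNReal.ofReal |g u - g' u| ∂ρ) := by
  have hB0 : 0 ≤ B := by
    obtain ⟨u⟩ : Nonempty (ι → E) := inferInstance
    exact (abs_nonneg _).trans (hfB u)
  have mem : ∀ {h : (ι → E) → ℝ}, Measurable h → (∀ u, |h u| ≤ B) → MemLp h 2 ρ := fun hh hB =>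
    MemLp.of_bound hh.aestronglyMeasurable B (ae_of_all _ hB)
  have Lf := mem hf hfB
  have Lf' := mem hf' hf'B
  have Lg := mem hg hgB
  have Lg' := mem hg' hg'B
  have hind : cov[f', g'; ρ] = 0 := by
    obtain ⟨F, hF, hFe⟩ := DependsOn.exists_measurable_factor hf' hS
    obtain ⟨G, hG, hGe⟩ := DependsOn.exists_measurable_factor hg' hT
    refine IndepFun.covariance_eq_zero ?_ Lf' Lg'
    have := (hρ.indepFun_finset S T hST fun i => measurable_pi_apply i).comp hF hG
    convert this using 1
    · exact funext hFe
    · exact funext hGe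
  -- The two functions are replaced one at a time; what remains is `cov[f', g']`, which vanishes.
  have hdec : cov[f, g; ρ] = cov[f - f', g; ρ] + cov[g - g', f'; ρ] := by
    rw [covariance_sub_left Lf Lf' Lg, covariance_sub_left Lg Lg' Lf', covariance_comm g f',
      covariance_comm g' f', hind]
    ring
  have i1 : Integrable (f - f') ρ := (Lf.sub Lf').integrable (by norm_num)
  have i2 : Integrable (g - g') ρ := (Lg.sub Lg').integrable (by norm_num)
  have b1 := abs_covariance_le_of_bounded i1 hg hgB
  have b2 := abs_covariance_le_of_bounded i2 hf' hf'B
  have c1 := ofReal_integral_eq_lintegral_ofReal i1.abs (ae_of_all _ fun _ => abs_nonneg _)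
  have c2 := ofReal_integral_eq_lintegral_ofReal i2.abs (ae_of_all _ fun _ => abs_nonneg _)
  simp only [Pi.sub_apply] at b1 b2 c1 c2
  rw [← c1, ← c2, ← ENNReal.ofReal_add (integral_nonneg fun _ => abs_nonneg _)
    (integral_nonneg fun _ => abs_nonneg _), ← ENNReal.ofReal_mul (by positivity)]
  refine ENNReal.ofReal_le_ofReal ?_
  rw [hdec, mul_add]
  exact (abs_add_le _ _).trans (add_le_add b1 b2)

end Covariance

/-! ### The equilibrium -/

/-- The derivative is `σ(1 - σ) ≤ 1/4`; this is the origin of the restriction `|ℓ| < 4`. -/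
theorem abs_sigmoid_sub_le (a b : ℝ) : |Real.sigmoid a - Real.sigmoid b| ≤ 1 / 4 * |a - b| := by
  have h : LipschitzWith (1 / 4) Real.sigmoid := by
    refine lipschitzWith_of_nnnorm_deriv_le differentiable_sigmoid fun x => ?_
    rw [← NNReal.coe_le_coe, coe_nnnorm, Real.deriv_sigmoid, Real.norm_eq_abs,
      abs_of_nonneg (mul_nonneg (Real.sigmoid_nonneg x) (by linarith [Real.sigmoid_le_one x]))]
    push_cast
    nlinarith [sq_nonneg (Real.sigmoid x - 1 / 2)]
  simpa [Real.dist_eq] using h.dist_le_mul a b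

section Equilibrium

variable {n kz : ℕ} (G : SimpleGraph (Fin n))

theorem adj_nonneg (i j : Fin n) : 0 ≤ adj G i j := by
  unfold adj; split_ifs <;> norm_num

theorem rowAdj_nonneg (i j : Fin n) : 0 ≤ rowAdj G i j :=
  mul_nonneg (inv_nonneg.2 (Finset.sum_nonneg fun _ _ => adj_nonneg G _ _)) (adj_nonneg G _ _)

theorem sum_rowAdj_le_one (i : Fin n) : ∑ j, rowAdj G i j ≤ 1 := by
  simp only [rowAdj, ← Finset.mul_sum]
  exact inv_mul_le_one

theorem abs_choiceIndex_sub_le (z : Fin n → Fin kz → ℝ) (b : Fin (kz + 1) → ℝ) (l : ℝ)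
    (p p' : Fin n → ℝ) (i : Fin n) :
    |choiceIndex G z b l p i - choiceIndex G z b l p' i| ≤ |l| * dist p p' := by
  have h : choiceIndex G z b l p i - choiceIndex G z b l p' i
      = l * ∑ j, rowAdj G i j * (p j - p' j) := by
    simp only [choiceIndex, mul_sub, Finset.sum_sub_distrib]; ring
  rw [h, abs_mul]
  refine mul_le_mul_of_nonneg_left ?_ (abs_nonneg l)
  calc |∑ j, rowAdj G i j * (p j - p' j)|
      ≤ ∑ j, rowAdj G i j * dist p p' := by
        refine (Finset.abs_sum_le_sum_abs _ _).trans (Finset.sum_le_sum fun j _ => ?_)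
        rw [abs_mul, abs_of_nonneg (rowAdj_nonneg G i j), ← Real.dist_eq]
        exact mul_le_mul_of_nonneg_left (dist_le_pi_dist p p' j) (rowAdj_nonneg G i j)
    _ ≤ 1 * dist p p' := by
        rw [← Finset.sum_mul]
        exact mul_le_mul_of_nonneg_right (sum_rowAdj_le_one G i) dist_nonneg
    _ = dist p p' := one_mul _

/-- The best-response map of the treatment game. -/
def bestResponse (z : Fin n → Fin kz → ℝ) (b : Fin (kz + 1) → ℝ) (l : ℝ) (p : Fin n → ℝ) :
    Fin n → ℝ :=
  fun i => Real.sigmoid (choiceIndex G z b l p i)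

/-- In the sup norm the row-normalised adjacency matrix has norm at most one, so the modulus is the
logistic slope `1/4` times `|l|`. -/
theorem contractingWith_bestResponse (z : Fin n → Fin kz → ℝ) (b : Fin (kz + 1) → ℝ) {l : ℝ}
    (hl : |l| < 4) : ContractingWith (Real.toNNReal (|l| / 4)) (bestResponse G z b l) := by
  refine ⟨?_, LipschitzWith.of_dist_le_mul fun p p' => ?_⟩
  · rw [← NNReal.coe_lt_coe, Real.coe_toNNReal _ (by positivity)]
    push_cast; linarith
  · rw [Real.coe_toNNReal _ (by positivity), dist_pi_le_iff (by positivity)]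
    intro i
    rw [Real.dist_eq]
    refine (abs_sigmoid_sub_le _ _).trans ?_
    have := abs_choiceIndex_sub_le G z b l p p' i
    linarith

theorem isEquilibrium_iff {z : Fin n → Fin kz → ℝ} {b : Fin (kz + 1) → ℝ} {l : ℝ}
    {p : Fin n → ℝ} : IsEquilibrium G z b l p ↔ Function.IsFixedPt (bestResponse G z b l) p :=
  ⟨fun h => funext fun i => (h i).symm, fun h i => (congrFun h i).symm⟩

theorem isEquilibrium_eqProb (z : Fin n → Fin kz → ℝ) (b : Fin (kz + 1) → ℝ) {l : ℝ}
    (hl : |l| < 4) : IsEquilibrium G z b l (eqProb G z b l) := by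
  have h : ∃ p, IsEquilibrium G z b l p :=
    ⟨_, (isEquilibrium_iff G).2 (contractingWith_bestResponse G z b hl).fixedPoint_isFixedPt⟩
  rw [eqProb, dif_pos h]
  exact h.choose_spec

theorem tendsto_iterate_bestResponse (z : Fin n → Fin kz → ℝ) (b : Fin (kz + 1) → ℝ) {l : ℝ}
    (hl : |l| < 4) :
    Tendsto (fun k => (bestResponse G z b l)^[k] 0) atTop (𝓝 (eqProb G z b l)) := by
  have hc := contractingWith_bestResponse G z b hl
  rw [hc.fixedPoint_unique ((isEquilibrium_iff G).1 (isEquilibrium_eqProb G z b hl))]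
  exact hc.tendsto_iterate_fixedPoint 0

@[fun_prop]
theorem measurable_withIntercept (i : Fin n) (k : Fin (kz + 1)) :
    Measurable fun z : Fin n → Fin kz → ℝ => withIntercept (z i) k := by
  refine Fin.cases ?_ (fun k => ?_) k
  · simp only [withIntercept, Fin.cons_zero]; fun_prop
  · simp only [withIntercept, Fin.cons_succ]; fun_prop

theorem measurable_choiceIndex (b : Fin (kz + 1) → ℝ) (l : ℝ)
    {P : (Fin n → Fin kz → ℝ) → Fin n → ℝ} (hP : Measurable P) (i : Fin n) :
    Measurable fun z => choiceIndex G z b l (P z) i := by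
  have : ∀ j, Measurable fun z => P z j := fun j => (measurable_pi_apply j).comp hP
  unfold choiceIndex; fun_prop

/-- `eqProb` is defined by choice, but uniqueness identifies it with the limit of the best-response
iterates from `0`, each of which is measurable in `z`. -/
theorem measurable_eqProb (b : Fin (kz + 1) → ℝ) {l : ℝ} (hl : |l| < 4) :
    Measurable fun z : Fin n → Fin kz → ℝ => eqProb G z b l := by
  refine measurable_of_tendsto_metrizable (f := fun k z => (bestResponse G z b l)^[k] 0)
    (fun k => ?_) (tendsto_pi_nhds.2 fun z => tendsto_iterate_bestResponse G z b hl)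
  induction k with
  | zero => exact measurable_const
  | succ k ih =>
    simp only [Function.iterate_succ', Function.comp_apply]
    refine measurable_pi_lambda _ fun i => ?_
    exact continuous_sigmoid.measurable.comp (measurable_choiceIndex G b l ih i)

/-- The inverse is the adjugate times the inverse determinant, with the convention `0⁻¹ = 0`;
invertibility plays no role. -/
theorem measurable_matrix_inv_apply {α ι : Type*} [MeasurableSpace α] [Fintype ι] [DecidableEq ι]
    {A : α → Matrix ι ι ℝ} (hA : ∀ i j, Measurable fun a => A a i j) (i j : ι) :
    Measurable fun a => (A a)⁻¹ i j := by
  have hA' : Measurable fun (a : α) (i : ι) (j : ι) => A a i j :=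
    measurable_pi_lambda _ fun i => measurable_pi_lambda _ fun j => hA i j
  have h1 : Continuous fun B : ι → ι → ℝ => Matrix.det (Matrix.of B) :=
    Continuous.matrix_det continuous_id
  have h2 : Continuous fun B : ι → ι → ℝ => Matrix.adjugate (Matrix.of B) i j :=
    (Continuous.matrix_adjugate (A := fun B : ι → ι → ℝ => Matrix.of B)
      continuous_id).matrix_elem i j
  simp only [Matrix.inv_def, Matrix.smul_apply, Ring.inverse_eq_inv', smul_eq_mul]
  exact ((h1.measurable.comp hA').inv).mul (h2.measurable.comp hA')

theorem measurable_scoreMatrix_inv (b : Fin (kz + 1) → ℝ) {l : ℝ} (hl : |l| < 4) (i j : Fin n) :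
    Measurable fun z : Fin n → Fin kz → ℝ => (scoreMatrix G z b l)⁻¹ i j := by
  refine measurable_matrix_inv_apply (fun i j => ?_) i j
  have hP : ∀ i, Measurable fun z : Fin n → Fin kz → ℝ => eqProb G z b l i := fun i =>
    (measurable_pi_apply i).comp (measurable_eqProb G b hl)
  simp only [scoreMatrix, Matrix.sub_apply, Matrix.diagonal_apply]
  split_ifs <;> fun_prop

theorem measurable_dProbBD (b : Fin (kz + 1) → ℝ) {l : ℝ} (hl : |l| < 4) (k : Fin (kz + 1))
    (j : Fin n) : Measurable fun z : Fin n → Fin kz → ℝ => dProbBD G z b l k j := by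
  simp only [dProbBD, Matrix.mulVec, dotProduct]
  exact Finset.measurable_sum _ fun i _ =>
    (measurable_scoreMatrix_inv G b hl j i).mul (measurable_withIntercept i k)

theorem measurable_dProbLam (b : Fin (kz + 1) → ℝ) {l : ℝ} (hl : |l| < 4)
    (j : Fin n) : Measurable fun z : Fin n → Fin kz → ℝ => dProbLam G z b l j := by
  have hP : ∀ i, Measurable fun z : Fin n → Fin kz → ℝ => eqProb G z b l i := fun i =>
    (measurable_pi_apply i).comp (measurable_eqProb G b hl)
  simp only [dProbLam, Matrix.mulVec, dotProduct]
  exact Finset.measurable_sum _ fun i _ => (measurable_scoreMatrix_inv G b hl j i).mul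
    (Finset.measurable_sum _ fun k _ => (hP k).const_mul _)

end Equilibrium

/-! ### Measurability of the moment function -/

section Moment

variable {n kz kx q : ℕ}

theorem measurable_control (t : Expo q) : Measurable (control t) := by
  unfold control; split_ifs <;> fun_prop

theorem measurable_secondStage {α : Type*} [MeasurableSpace α] (t : Expo q) {p : α → ℝ}
    {w : α → WPoint q} {x : α → Fin kx → ℝ} (hp : Measurable p) (hw : Measurable w)
    (hx : Measurable x) (b : Fin kx ⊕ Unit → ℝ) (c : Fin kx ⊕ Unit) :
    Measurable fun a => secondStage t (p a) (w a) (x a) b c := by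
  classical
  have hc := (measurable_control t).comp hp
  have hx' : ∀ k, Measurable fun a => x a k := fun k => (measurable_pi_apply k).comp hx
  have hw1 : Measurable fun a => (w a).1 := hw.fst
  have hi : Measurable fun a => if (w a).2.1 = t then (1 : ℝ) else 0 :=
    Measurable.ite (hw.snd.fst (measurableSet_singleton t)) measurable_const measurable_const
  simp only [Function.comp_def] at hc
  cases c <;> simp only [secondStage, Sum.elim_inl, Sum.elim_inr] <;> fun_prop

theorem measurable_moment (t t' : Expo q) (G : SimpleGraph (Fin n)) (i : Fin n)
    (β : Param kz kx) (hβ : |paramLam β| < 4) :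
    Measurable fun a : WPoint q × (Fin kx → ℝ) × (Fin n → Fin kz → ℝ) =>
      moment t t' G i a.1 a.2.1 a.2.2 β := by
  refine (MeasurableEquiv.toLp 2 _).measurable.comp (measurable_pi_lambda _ fun c => ?_)
  have hz : Measurable fun a : WPoint q × (Fin kx → ℝ) × (Fin n → Fin kz → ℝ) => a.2.2 := by
    fun_prop
  have hd : Measurable fun a : WPoint q × (Fin kx → ℝ) × (Fin n → Fin kz → ℝ) => a.1.2.2 := by
    fun_prop
  have hP : ∀ i, Measurable fun a : WPoint q × (Fin kx → ℝ) × (Fin n → Fin kz → ℝ) =>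
      eqProb G a.2.2 (paramD β) (paramLam β) i := fun i =>
    (measurable_pi_apply i).comp ((measurable_eqProb G (paramD β) hβ).comp hz)
  have h1 : ∀ k j, Measurable fun a : WPoint q × (Fin kx → ℝ) × (Fin n → Fin kz → ℝ) =>
      dProbBD G a.2.2 (paramD β) (paramLam β) k j := fun k j =>
    (measurable_dProbBD G (paramD β) hβ k j).comp hz
  have h2 : ∀ j, Measurable fun a : WPoint q × (Fin kx → ℝ) × (Fin n → Fin kz → ℝ) =>
      dProbLam G a.2.2 (paramD β) (paramLam β) j := fun j =>
    (measurable_dProbLam G (paramD β) hβ j).comp hz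
  have h3 : ∀ k, Measurable fun a : WPoint q × (Fin kx → ℝ) × (Fin n → Fin kz → ℝ) =>
      withIntercept (a.2.2 i) k := fun k => (measurable_withIntercept i k).comp hz
  rcases c with (k | _) | (c | c)
  · simp only [Sum.elim_inl]; fun_prop
  · simp only [Sum.elim_inl, Sum.elim_inr]; fun_prop
  · simp only [Sum.elim_inl, Sum.elim_inr]
    exact measurable_secondStage t (hP i) measurable_fst measurable_snd.fst _ c
  · simp only [Sum.elim_inr]
    exact measurable_secondStage t' (hP i) measurable_fst measurable_snd.fst _ c

end Moment

/-- Networks and treatment vectors of a row take finitely many values, so they can be held fixed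
while measurability in the remaining arguments is checked. -/
theorem measurable_of_countable_parameter {α γ ι : Type*} [MeasurableSpace α] [MeasurableSpace γ]
    [Countable ι] {τ : α → ι} (hτ : ∀ c, MeasurableSet {a | τ a = c}) {H : ι → α → γ}
    (hH : ∀ c, Measurable (H c)) : Measurable fun a => H (τ a) a := by
  intro s hs
  have : (fun a => H (τ a) a) ⁻¹' s = ⋃ c, {a | τ a = c} ∩ H c ⁻¹' s := by
    ext a; simp
  rw [this]
  exact MeasurableSet.iUnion fun c => (hτ c).inter (hH c hs)

theorem measurableSet_of_countable_parameter {α ι : Type*} [MeasurableSpace α]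
    [Countable ι] {τ : α → ι} (hτ : ∀ c, MeasurableSet {a | τ a = c}) {S : ι → Set α}
    (hS : ∀ c, MeasurableSet (S c)) : MeasurableSet {a | a ∈ S (τ a)} := by
  have : {a | a ∈ S (τ a)} = ⋃ c, {a | τ a = c} ∩ S c := by
    ext a; simp
  rw [this]
  exact MeasurableSet.iUnion fun c => (hτ c).inter (hS c)

/-! ### The data as functions of the common shocks and the node shocks -/

namespace NetworkModel

variable {Ω : Type*} {kz kx q : ℕ} (M : NetworkModel Ω kz kx q)

/-- The exposure levels that occur in rows with `n` nodes. -/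
def Levels (n : ℕ) : Set (Expo q) :=
  Set.range fun a : SimpleGraph (Fin n) × Fin n × (Fin n → Bool) => M.expo n a.1 a.2.1 a.2.2

/-- Finiteness makes `NodeShock` standard Borel, as a regular conditional distribution requires. The
errors indexed by all of `Expo q` would form an uncountable product. -/
instance (n : ℕ) : Finite (M.Levels n) := inferInstanceAs (Finite (Set.range _))

/-- An exposure level as an element of the set of levels. -/
def level (n : ℕ) (G : SimpleGraph (Fin n)) (i : Fin n) (d : Fin n → Bool) : M.Levels n :=
  ⟨M.expo n G i d, (G, i, d), rfl⟩

/-- The private shock of a node and its outcome errors at the exposure levels. -/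
abbrev NodeShock (n : ℕ) : Type := ℝ × (M.Levels n → ℝ)

/-- The sample space with the `σ`-algebra of the common shocks of row `n`. -/
def CommonShocks (_M : NetworkModel Ω kz kx q) (_n : ℕ) : Type _ := Ω

instance (n : ℕ) : MeasurableSpace (M.CommonShocks n) := M.C n

/-- Viewed as a map into `Ω` with the `σ`-algebra `C n`, the identity turns conditioning on `C n`
into conditioning on a random element, so that `condDistrib` applies. -/
def toCommon (n : ℕ) : Ω → M.CommonShocks n := id

theorem comap_toCommon (n : ℕ) :
    MeasurableSpace.comap (M.toCommon n) (inferInstance : MeasurableSpace (M.CommonShocks n))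
      = M.C n :=
  MeasurableSpace.comap_id

/-- The shocks of all nodes of row `n`. -/
def nodeShocks (n : ℕ) (ω : Ω) : Fin n → M.NodeShock n :=
  fun i => (M.ν n i ω, fun a => M.e n i ω a)

/-- The network as a function of the common shocks. -/
def netAt (n : ℕ) (c : M.CommonShocks n) : SimpleGraph (Fin n) := M.A n c

def covAt (n : ℕ) (i : Fin n) (c : M.CommonShocks n) : Fin kx → ℝ := M.X n i c

def exoAt (n : ℕ) (c : M.CommonShocks n) : Fin n → Fin kz → ℝ := M.Zmat n c

/-- The treatments as a function of the common shocks and the shocks of the nodes. -/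
def treatAt (n : ℕ) (c : M.CommonShocks n) (u : Fin n → M.NodeShock n) : Fin n → Bool :=
  treat (M.netAt n c) (M.exoAt n c) M.bD M.lam fun j => (u j).1

/-- The point `(y, t, d)` of node `i` with shock `a` under the treatment vector `d`. -/
def pointAt (n : ℕ) (G : SimpleGraph (Fin n)) (i : Fin n) (x : Fin kx → ℝ) (a : M.NodeShock n)
    (d : Fin n → Bool) : WPoint q :=
  ((∑ k, x k * M.bX (M.expo n G i d) k) + Real.sigmoid a.1 * M.bp (M.expo n G i d)
      + a.2 (M.level n G i d),
    M.expo n G i d, bval (d i))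

/-- `W_{n,i}` as a function of the common shocks and the shocks of the nodes. -/
def WAt (n : ℕ) (i : Fin n) (c : M.CommonShocks n) (u : Fin n → M.NodeShock n) : WPoint q :=
  M.pointAt n (M.netAt n c) i (M.covAt n i c) (u i) (M.treatAt n c u)

/-- `W_{n,i}` with the treatments outside `N(i,s)` set to zero. -/
def WTruncAt (n : ℕ) (i : Fin n) (s : ℕ) (c : M.CommonShocks n) (u : Fin n → M.NodeShock n) :
    WPoint q :=
  M.pointAt n (M.netAt n c) i (M.covAt n i c) (u i)
    (truncTreat (M.netAt n c) i s (M.treatAt n c u))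

/-- The data `(W_{n,i}, X_{n,i}, 𝐙)` as a function of the shocks. -/
def dataAt (n : ℕ) (i : Fin n) (p : M.CommonShocks n × (Fin n → M.NodeShock n)) :
    WPoint q × (Fin kx → ℝ) × (Fin n → Fin kz → ℝ) :=
  (M.WAt n i p.1 p.2, M.covAt n i p.1, M.exoAt n p.1)

/-- The moments of node `i` as a function of the shocks. -/
def gAt (t t' : Expo q) (n : ℕ) (i : Fin n) (β : Param kz kx)
    (p : M.CommonShocks n × (Fin n → M.NodeShock n)) : Param kz kx :=
  moment t t' (M.netAt n p.1) i (M.WAt n i p.1 p.2) (M.covAt n i p.1) (M.exoAt n p.1) β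

section Measurability

variable {M} [MeasurableSpace Ω]

theorem measurable_toCommon (hM : M.IsMeasurable) (n : ℕ) : Measurable (M.toCommon n) :=
  fun s hs => hM.le n s hs

theorem measurable_nodeShocks (hM : M.IsMeasurable) (n : ℕ) : Measurable (M.nodeShocks n) :=
  measurable_pi_lambda _ fun i => (hM.shocks n i).prodMk
    (measurable_pi_lambda _ fun _ => (measurable_pi_apply _).comp (hM.errors n i))

theorem measurableSet_netAt_eq (hM : M.IsMeasurable) (n : ℕ) (G : SimpleGraph (Fin n)) :
    MeasurableSet {c | M.netAt n c = G} := by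
  have h : {c | M.netAt n c = G} = ⋂ i, ⋂ j, {c | (M.netAt n c).Adj i j ↔ G.Adj i j} := by
    ext c
    simp only [Set.mem_ofPred_eq, Set.mem_iInter]
    exact ⟨fun h i j => by rw [h], fun h => by ext i j; exact h i j⟩
  rw [h]
  refine MeasurableSet.iInter fun i => MeasurableSet.iInter fun j => ?_
  have h1 : MeasurableSet {c : M.CommonShocks n | (M.netAt n c).Adj i j} := hM.network n i j
  by_cases hG : G.Adj i j
  · simpa [hG] using h1
  · have h2 : {c | (M.netAt n c).Adj i j ↔ G.Adj i j} = {c | (M.netAt n c).Adj i j}ᶜ := by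
      ext c; simp [hG]
    rw [h2]
    exact h1.compl

theorem measurable_covAt (hM : M.IsMeasurable) (n : ℕ) (i : Fin n) : Measurable (M.covAt n i) :=
  hM.covariates n i

theorem measurable_exoAt (hM : M.IsMeasurable) (n : ℕ) : Measurable (M.exoAt n) :=
  measurable_pi_lambda _ fun i => (show Measurable[M.C n] (M.Z n i) from hM.exogenous n i)

theorem measurable_treatAt (hM : M.IsMeasurable) (hlam : |M.lam| < 4) (n : ℕ) :
    Measurable fun p : M.CommonShocks n × (Fin n → M.NodeShock n) => M.treatAt n p.1 p.2 := by
  refine measurable_pi_lambda _ fun i => ?_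
  refine measurable_of_countable_parameter
    (τ := fun p : M.CommonShocks n × (Fin n → M.NodeShock n) => M.netAt n p.1)
    (H := fun G p => treat G (M.exoAt n p.1) M.bD M.lam (fun j => (p.2 j).1) i)
    (fun G => measurable_fst (measurableSet_netAt_eq hM n G)) fun G => ?_
  have h1 : Measurable fun p : M.CommonShocks n × (Fin n → M.NodeShock n) =>
      choiceIndex G (M.exoAt n p.1) M.bD M.lam (eqProb G (M.exoAt n p.1) M.bD M.lam) i
        - (p.2 i).1 :=
    (((measurable_choiceIndex G M.bD M.lam (measurable_eqProb G M.bD hlam) i).comp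
      (measurable_exoAt hM n)).comp measurable_fst).sub (by fun_prop)
  refine measurable_to_bool ?_
  simp only [treat, Set.preimage, Set.mem_singleton_iff, decide_eq_true_eq]
  exact h1 measurableSet_Ici

theorem measurable_pointAt (hM : M.IsMeasurable) (hlam : |M.lam| < 4) (n : ℕ) (i : Fin n)
    (φ : SimpleGraph (Fin n) → (Fin n → Bool) → Fin n → Bool) :
    Measurable fun p : M.CommonShocks n × (Fin n → M.NodeShock n) =>
      M.pointAt n (M.netAt n p.1) i (M.covAt n i p.1) (p.2 i)
        (φ (M.netAt n p.1) (M.treatAt n p.1 p.2)) := by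
  refine measurable_of_countable_parameter
    (τ := fun p : M.CommonShocks n × (Fin n → M.NodeShock n) =>
      (M.netAt n p.1, M.treatAt n p.1 p.2))
    (H := fun a p => M.pointAt n a.1 i (M.covAt n i p.1) (p.2 i) (φ a.1 a.2)) ?_ ?_
  · rintro ⟨G, d⟩
    simp only [Prod.mk.injEq]
    exact (measurable_fst (measurableSet_netAt_eq hM n G)).inter
      (measurable_treatAt hM hlam n (measurableSet_singleton d))
  · rintro ⟨G, d⟩
    have hx : ∀ k, Measurable fun p : M.CommonShocks n × (Fin n → M.NodeShock n) =>
        M.covAt n i p.1 k := fun k =>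
      (measurable_pi_apply k).comp ((measurable_covAt hM n i).comp measurable_fst)
    have hs : Measurable fun p : M.CommonShocks n × (Fin n → M.NodeShock n) =>
        Real.sigmoid (p.2 i).1 :=
      continuous_sigmoid.measurable.comp (by fun_prop)
    refine Measurable.prodMk ?_ measurable_const
    have he : Measurable fun p : M.CommonShocks n × (Fin n → M.NodeShock n) =>
        (p.2 i).2 (M.level n G i (φ G d)) := by fun_prop
    exact ((Finset.measurable_sum _ fun k _ => (hx k).mul_const _).add (hs.mul_const _)).add he

theorem measurable_WAt (hM : M.IsMeasurable) (hlam : |M.lam| < 4) (n : ℕ) (i : Fin n) :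
    Measurable fun p : M.CommonShocks n × (Fin n → M.NodeShock n) => M.WAt n i p.1 p.2 :=
  measurable_pointAt hM hlam n i fun _ d => d

theorem measurable_WTruncAt (hM : M.IsMeasurable) (hlam : |M.lam| < 4) (n : ℕ) (i : Fin n) (s : ℕ) :
    Measurable fun p : M.CommonShocks n × (Fin n → M.NodeShock n) => M.WTruncAt n i s p.1 p.2 :=
  measurable_pointAt hM hlam n i fun G d => truncTreat G i s d

theorem measurable_dataAt (hM : M.IsMeasurable) (hlam : |M.lam| < 4) (n : ℕ) (i : Fin n) :
    Measurable (M.dataAt n i) :=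
  (measurable_WAt hM hlam n i).prodMk (((measurable_covAt hM n i).comp measurable_fst).prodMk
    ((measurable_exoAt hM n).comp measurable_fst))

theorem measurable_gAt (hM : M.IsMeasurable) (hlam : |M.lam| < 4) (t t' : Expo q) (n : ℕ)
    (i : Fin n) {β : Param kz kx} (hβ : |paramLam β| < 4) : Measurable (M.gAt t t' n i β) :=
  measurable_of_countable_parameter
    (τ := fun p : M.CommonShocks n × (Fin n → M.NodeShock n) => M.netAt n p.1)
    (H := fun G p => moment t t' G i (M.dataAt n i p).1 (M.dataAt n i p).2.1
      (M.dataAt n i p).2.2 β)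
    (fun G => measurable_fst (measurableSet_netAt_eq hM n G))
    fun G => (measurable_moment t t' G i β hβ).comp (measurable_dataAt hM hlam n i)

theorem measurable_nodeData (hM : M.IsMeasurable) (n : ℕ) :
    Measurable fun ω => (M.toCommon n ω, M.nodeShocks n ω) :=
  (measurable_toCommon hM n).prodMk (measurable_nodeShocks hM n)

variable {μ : Measure Ω}

theorem ae_mem_dataSupport (hM : M.IsMeasurable) (hlam : |M.lam| < 4) (n : ℕ) (i : Fin n) :
    ∀ᵐ ω ∂μ, M.dataAt n i (M.toCommon n ω, M.nodeShocks n ω)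
      ∈ M.dataSupport μ n i (M.netAt n (M.toCommon n ω)) := by
  have key : ∀ G : SimpleGraph (Fin n), ∀ᵐ ω ∂μ, M.netAt n (M.toCommon n ω) = G →
      M.dataAt n i (M.toCommon n ω, M.nodeShocks n ω) ∈ M.dataSupport μ n i G := by
    intro G
    have hms : MeasurableSet {ω | M.A n ω = G} :=
      measurable_toCommon hM n (measurableSet_netAt_eq hM n G)
    have hd : Measurable fun ω => (M.W n i ω, M.X n i ω, M.Zmat n ω) :=
      (measurable_dataAt hM hlam n i).comp (measurable_nodeData hM n)
    have h1 : ∀ᵐ x ∂((μ.restrict {ω | M.A n ω = G}).map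
        fun ω => (M.W n i ω, M.X n i ω, M.Zmat n ω)), x ∈ M.dataSupport μ n i G :=
      Measure.support_mem_ae
    have h2 := ae_of_ae_map hd.aemeasurable h1
    rw [ae_restrict_iff' hms] at h2
    exact h2
  filter_upwards [ae_all_iff.2 key] with ω hω using hω _ rfl

theorem measurableSet_dataAt_mem (hM : M.IsMeasurable) (hlam : |M.lam| < 4) (n : ℕ) (i : Fin n) :
    MeasurableSet {p | M.dataAt n i p ∈ M.dataSupport μ n i (M.netAt n p.1)} :=
  measurableSet_of_countable_parameter
    (τ := fun p : M.CommonShocks n × (Fin n → M.NodeShock n) => M.netAt n p.1)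
    (S := fun G => M.dataAt n i ⁻¹' M.dataSupport μ n i G)
    (fun G => measurable_fst (measurableSet_netAt_eq hM n G))
    fun _ => measurable_dataAt hM hlam n i Measure.isClosed_support.measurableSet

end Measurability

section Independence

variable {M} [MeasurableSpace Ω] {μ : Measure Ω}

theorem condIndepFamily_nodeShocks (hS : M.ShockAssumption μ) (n : ℕ) :
    CondIndepFamily (M.C n) μ fun i ω => M.nodeShocks n ω i := by
  intro B hB
  have hφ : ∀ i : Fin n, Measurable fun p : ℝ × (Expo q → ℝ) =>
      ((p.1, fun a => p.2 a) : M.NodeShock n) := fun i => by fun_prop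
  exact hS.indep n (fun i => (fun p : ℝ × (Expo q → ℝ) =>
      ((p.1, fun a => p.2 a) : M.NodeShock n)) ⁻¹' B i) fun i => hφ i (hB i)

end Independence

end NetworkModel

/-! ### Bounded Lipschitz extensions -/

theorem wDist_le_two_mul_dist {q : ℕ} (w w' : WPoint q) : wDist w w' ≤ 2 * dist w w' := by
  have h1 : |w.1 - w'.1| ≤ dist w w' := by
    rw [← Real.dist_eq]; exact le_max_left _ _
  have h2 : ‖w.2.1 - w'.2.1‖ ≤ dist w w' := by
    rw [← dist_eq_norm]; exact (le_max_left _ _).trans (le_max_right (dist w.1 w'.1) _)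
  have h3 : |w.2.2 - w'.2.2| ≤ dist w w' := by
    rw [← Real.dist_eq]; exact (le_max_right _ _).trans (le_max_right (dist w.1 w'.1) _)
  have h0 : 0 ≤ dist w w' := dist_nonneg
  refine Real.sqrt_le_iff.2 ⟨by positivity, ?_⟩
  nlinarith [pow_le_pow_left₀ (abs_nonneg _) h1 2, pow_le_pow_left₀ (norm_nonneg _) h2 2,
    pow_le_pow_left₀ (abs_nonneg _) h3 2]

/-- Coordinatewise extension of a bounded Lipschitz function with preservation of the bound. -/
theorem exists_bounded_lipschitz_extension {q : ℕ} {ι : Type*} [Fintype ι] {S : Set (WPoint q)}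
    {f : WPoint q → EuclideanSpace ℝ ι} {B L : ℝ} (hB0 : 0 ≤ B) (hB : ∀ w ∈ S, ‖f w‖ ≤ B)
    (hL : ∀ w ∈ S, ∀ w' ∈ S, ‖f w - f w'‖ ≤ L * wDist w w') :
    ∃ h : WPoint q → ι → ℝ, (∀ a, Continuous fun w => h w a) ∧ (∀ w a, |h w a| ≤ B) ∧
      (∀ w w' a, |h w a - h w' a| ≤ 2 * |L| * dist w w') ∧ ∀ w ∈ S, ∀ a, h w a = f w a := by
  have key : ∀ a, ∃ g : WPoint q → ℝ, LipschitzWith (Real.toNNReal (2 * |L|)) g ∧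
      Set.EqOn (fun w => f w a) g S := fun a => by
    refine LipschitzOnWith.extend_real (LipschitzOnWith.of_dist_le_mul fun w hw w' hw' => ?_)
    rw [Real.coe_toNNReal _ (by positivity), Real.dist_eq]
    have h1 : |f w a - f w' a| ≤ ‖f w - f w'‖ := by
      simpa using PiLp.norm_apply_le (f w - f w') a
    have h2 : L * wDist w w' ≤ |L| * (2 * dist w w') :=
      mul_le_mul (le_abs_self L) (wDist_le_two_mul_dist w w') (Real.sqrt_nonneg _) (abs_nonneg L)
    linarith [hL w hw w' hw']
  choose g hg hgS using key
  -- Clipping the real-valued extension to `[-B, B]` keeps the Lipschitz constant and, on `S`, the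
  -- values.
  have hlip : ∀ a, LipschitzWith (Real.toNNReal (2 * |L|)) fun w => max (-B) (min B (g a w)) :=
    fun a => ((hg a).const_min B).const_max (-B)
  refine ⟨fun w a => max (-B) (min B (g a w)), fun a => (hlip a).continuous, fun w a => ?_,
    fun w w' a => ?_, fun w hw a => ?_⟩
  · exact abs_le.2 ⟨le_max_left _ _, max_le (by linarith) (min_le_left _ _)⟩
  · have := (hlip a).dist_le_mul w w'
    rwa [Real.coe_toNNReal _ (by positivity), Real.dist_eq] at this
  · have h1 : |f w a| ≤ B := (PiLp.norm_apply_le (f w) a).trans (hB w hw)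
    have h2 : g a w = f w a := (hgS a hw).symm
    change max (-B) (min B (g a w)) = f w a
    rw [h2, min_eq_right (abs_le.1 h1).2, max_eq_right (abs_le.1 h1).1]

/-! ### Variance of averages over a network -/

section Network

variable {n : ℕ} (G : SimpleGraph (Fin n))

theorem mem_nbhd {i j : Fin n} {s : ℕ} : j ∈ nbhd G i s ↔ G.edist i j ≤ (s : ℕ∞) := by
  simp [nbhd]

theorem mem_sphere {i j : Fin n} {s : ℕ} : j ∈ sphere G i s ↔ G.edist i j = (s : ℕ∞) := by
  simp [sphere]

theorem self_mem_nbhd (i : Fin n) (s : ℕ) : i ∈ nbhd G i s := by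
  simp [mem_nbhd]

theorem disjoint_nbhd {i j : Fin n} {r : ℕ} (h : ((2 * r : ℕ) : ℕ∞) < G.edist i j) :
    Disjoint (nbhd G i r) (nbhd G j r) := by
  rw [Finset.disjoint_left]
  intro k hi hj
  rw [mem_nbhd] at hi hj
  rw [SimpleGraph.edist_comm] at hj
  have := (SimpleGraph.edist_triangle (G := G) (u := i) (v := k) (w := j)).trans
    (add_le_add hi hj)
  rw [← Nat.cast_add, ← two_mul] at this
  exact absurd this (not_le.2 h)

theorem truncTreat_self (i : Fin n) (s : ℕ) (d : Fin n → Bool) : truncTreat G i s d i = d i := by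
  simp [truncTreat, self_mem_nbhd]

/-- Conditional variance of the average of functions of the nodes that are approximately functions
of the independent shocks in their neighbourhoods. -/
theorem ofReal_variance_average_le {E : Type*} [MeasurableSpace E] [Nonempty E]
    {ρ : Measure (Fin n → E)} [IsProbabilityMeasure ρ]
    (hρ : iIndepFun (fun (i : Fin n) (u : Fin n → E) => u i) ρ) (hn : 0 < n)
    {f : Fin n → (Fin n → E) → ℝ} {f' : ℕ → Fin n → (Fin n → E) → ℝ} {B : ℝ}
    (hf : ∀ i, Measurable (f i)) (hf' : ∀ r i, Measurable (f' r i))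
    (hfB : ∀ i u, |f i u| ≤ B) (hf'B : ∀ r i u, |f' r i u| ≤ B)
    (hloc : ∀ r i, DependsOn (f' r i) (nbhd G i r : Set (Fin n)))
    {K : ℕ} (hK : ∀ i, f' K i = f i) (hKn : 2 * K ≤ n) {η : ℕ → ℝ≥0∞}
    (hη : ∀ r i, ∫⁻ u, ENNReal.ofReal |f i u - f' r i u| ∂ρ ≤ η r) :
    ENNReal.ofReal (Var[fun u => (n : ℝ)⁻¹ * ∑ i, f i u; ρ]) ≤
      (n : ℝ≥0∞)⁻¹ * ENNReal.ofReal (2 * B * B) + ENNReal.ofReal (2 * B) * ((n : ℝ≥0∞)⁻¹ *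
        ∑ s ∈ Finset.Icc 1 n, sphereAvg G s * (2 * η ((s - 1) / 4))) := by
  classical
  have hn0 : (n : ℝ≥0∞) ≠ 0 := by exact_mod_cast hn.ne'
  have hnt : (n : ℝ≥0∞) ≠ ∞ := ENNReal.natCast_ne_top n
  have hB0 : 0 ≤ B := by
    obtain ⟨u⟩ : Nonempty (Fin n → E) := inferInstance
    exact (abs_nonneg _).trans (hfB ⟨0, hn⟩ u)
  have h_int : ∀ i, Integrable (f i) ρ := fun i =>
    Integrable.of_bound (hf i).aestronglyMeasurable B (ae_of_all _ (hfB i))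
  have hL2 : ∀ i, MemLp (f i) 2 ρ := fun i =>
    MemLp.of_bound (hf i).aestronglyMeasurable B (ae_of_all _ (hfB i))
  have hdiag : ∀ i, ENNReal.ofReal |cov[f i, f i; ρ]| ≤ ENNReal.ofReal (2 * B * B) := by
    intro i
    refine ENNReal.ofReal_le_ofReal
      ((abs_covariance_le_of_bounded (h_int i) (hf i) (hfB i)).trans ?_)
    refine mul_le_mul_of_nonneg_left ?_ (by positivity)
    have := integral_mono (h_int i).abs (integrable_const B) (hfB i)
    simpa using this
  have hcov : ∀ r i j, ((2 * r : ℕ) : ℕ∞) < G.edist i j →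
      ENNReal.ofReal |cov[f i, f j; ρ]| ≤ ENNReal.ofReal (2 * B) *
        ((∫⁻ u, ENNReal.ofReal |f i u - f' r i u| ∂ρ)
          + ∫⁻ u, ENNReal.ofReal |f j u - f' r j u| ∂ρ) := fun r i j h =>
    ofReal_abs_covariance_le hρ (disjoint_nbhd G h) (hf i) (hf' r i) (hf j) (hf' r j) (hfB i)
      (hf'B r i) (hfB j) (hf'B r j) (hloc r i) (hloc r j)
  have hoff : ∀ i j, i ≠ j → ENNReal.ofReal |cov[f i, f j; ρ]| ≤
      ∑ s ∈ Finset.Icc 1 n, if j ∈ sphere G i s then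
        ENNReal.ofReal (2 * B) * (2 * η ((s - 1) / 4)) else 0 := by
    intro i j hij
    -- Truncation at radius `K` is exact, so nodes more than `2K` apart, including those in
    -- different components, are uncorrelated. All other distances are at most `2K ≤ n` and occur in
    -- the sum.
    by_cases hd : ((2 * K : ℕ) : ℕ∞) < G.edist i j
    · refine (hcov K i j hd).trans ?_
      simp [hK]
    · have hd' := not_lt.1 hd
      obtain ⟨s, hs⟩ := ENat.ne_top_iff_exists.1 (ne_top_of_le_ne_top (ENat.natCast_ne_top _) hd')
      rw [← hs] at hd'
      have hsK : s ≤ 2 * K := by exact_mod_cast hd'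
      have hs1 : 1 ≤ s := by
        rcases Nat.eq_zero_or_pos s with h0 | h0
        · subst h0
          exact absurd (SimpleGraph.edist_eq_zero_iff.1 hs.symm) hij
        · exact h0
      refine le_trans ?_ (Finset.single_le_sum (fun _ _ => zero_le)
        (Finset.mem_Icc.2 ⟨hs1, hsK.trans hKn⟩))
      rw [if_pos ((mem_sphere G).2 hs.symm)]
      -- The radius `r = (s - 1) / 4` satisfies `4r + 1 ≤ s`, more than the `2r < s` that
      -- disjointness needs.
      refine (hcov ((s - 1) / 4) i j ?_).trans ?_
      · rw [← hs]; exact_mod_cast (by omega : 2 * ((s - 1) / 4) < s)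
      · rw [two_mul (η _)]
        gcongr <;> exact hη _ _
  have hpair : ∀ i j, ENNReal.ofReal |cov[f i, f j; ρ]| ≤
      (if i = j then ENNReal.ofReal (2 * B * B) else 0) +
      ∑ s ∈ Finset.Icc 1 n, if j ∈ sphere G i s then
        ENNReal.ofReal (2 * B) * (2 * η ((s - 1) / 4)) else 0 := by
    intro i j
    by_cases hij : i = j
    · subst hij
      rw [if_pos rfl]
      exact (hdiag i).trans le_self_add
    · rw [if_neg hij, zero_add]
      exact hoff i j hij
  have hvar : ENNReal.ofReal (Var[fun u => (n : ℝ)⁻¹ * ∑ i, f i u; ρ]) ≤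
      (n : ℝ≥0∞)⁻¹ * ((n : ℝ≥0∞)⁻¹ * ∑ i, ∑ j, ENNReal.ofReal |cov[f i, f j; ρ]|) := by
    rw [variance_const_mul, variance_fun_sum hL2, ← mul_assoc, ENNReal.ofReal_mul (sq_nonneg _),
      sq, ENNReal.ofReal_mul (by positivity), ENNReal.ofReal_inv_of_pos (by exact_mod_cast hn),
      ENNReal.ofReal_natCast]
    gcongr
    refine (ENNReal.ofReal_le_ofReal ((le_abs_self _).trans ((Finset.abs_sum_le_sum_abs _ _).trans
      (Finset.sum_le_sum fun i _ => Finset.abs_sum_le_sum_abs _ _)))).trans ?_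
    rw [ENNReal.ofReal_sum_of_nonneg fun i _ => Finset.sum_nonneg fun j _ => abs_nonneg _]
    refine Finset.sum_le_sum fun i _ => ?_
    rw [ENNReal.ofReal_sum_of_nonneg fun j _ => abs_nonneg _]
  have hsum : ∑ i, ∑ j, ENNReal.ofReal |cov[f i, f j; ρ]| ≤
      n * ENNReal.ofReal (2 * B * B) + ∑ s ∈ Finset.Icc 1 n,
        (∑ i, ((sphere G i s).card : ℝ≥0∞)) * (ENNReal.ofReal (2 * B) * (2 * η ((s - 1) / 4))) := by
    refine (Finset.sum_le_sum fun i _ => Finset.sum_le_sum fun j _ => hpair i j).trans_eq ?_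
    simp only [Finset.sum_add_distrib, Finset.sum_ite_eq, Finset.mem_univ, if_true]
    congr 1
    · simp
    · simp_rw [Finset.sum_comm (s := Finset.univ) (t := Finset.Icc 1 n)]
      refine Finset.sum_congr rfl fun s _ => ?_
      rw [Finset.sum_mul]
      refine Finset.sum_congr rfl fun i _ => ?_
      rw [Finset.sum_ite_mem, Finset.univ_inter, Finset.sum_const, nsmul_eq_mul]
  refine hvar.trans ?_
  grw [hsum]
  rw [mul_add, ← mul_assoc _ (n : ℝ≥0∞), ENNReal.inv_mul_cancel hn0 hnt, one_mul, mul_add]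
  refine add_le_add le_rfl (le_of_eq ?_)
  simp only [Finset.mul_sum]
  refine Finset.sum_congr rfl fun s _ => ?_
  rw [sphereAvg]
  ring

end Network

theorem lintegral_sq_norm_sub_mean {α ι : Type*} [MeasurableSpace α] [Fintype ι] {ρ : Measure α}
    [IsProbabilityMeasure ρ] {F : α → EuclideanSpace ℝ ι} {f : ι → α → ℝ}
    (hf : ∀ a, MemLp (f a) 2 ρ) (hF : ∀ᵐ u ∂ρ, ∀ a, F u a = f a u) {v : EuclideanSpace ℝ ι}
    (hv : ∀ a, v a = ∫ u, f a u ∂ρ) :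
    ∫⁻ u, ENNReal.ofReal (‖F u - v‖ ^ 2) ∂ρ = ∑ a, ENNReal.ofReal (Var[f a; ρ]) := by
  simp_rw [fun a => ofReal_variance (hf a), evariance_eq_lintegral_ofReal]
  rw [← lintegral_finsetSum' _ fun a _ => by
    have := (hf a).aestronglyMeasurable.aemeasurable
    fun_prop]
  refine lintegral_congr_ae ?_
  filter_upwards [hF] with u hu
  rw [EuclideanSpace.norm_sq_eq, ENNReal.ofReal_sum_of_nonneg fun a _ => sq_nonneg _]
  refine Finset.sum_congr rfl fun a _ => ?_
  rw [Real.norm_eq_abs, sq_abs, PiLp.sub_apply, hu, hv]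

namespace NetworkModel

variable {Ω : Type*} {kz kx q : ℕ} {M : NetworkModel Ω kz kx q}

/-! ### The law of large numbers given the common shocks -/

/-- Private information: other nodes enter the choice only through equilibrium probabilities, which
are functions of `c`. This makes the truncated data local. -/
theorem treatAt_congr {n : ℕ} (c : M.CommonShocks n) {u v : Fin n → M.NodeShock n} {i : Fin n}
    (h : u i = v i) : M.treatAt n c u i = M.treatAt n c v i := by
  simp [treatAt, treat, h]

theorem dependsOn_WTruncAt {n : ℕ} (i : Fin n) (s : ℕ) (c : M.CommonShocks n) :
    DependsOn (M.WTruncAt n i s c) (nbhd (M.netAt n c) i s : Set (Fin n)) := by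
  intro u v huv
  have hi : u i = v i := huv i (self_mem_nbhd _ i s)
  have hd : truncTreat (M.netAt n c) i s (M.treatAt n c u)
      = truncTreat (M.netAt n c) i s (M.treatAt n c v) := by
    funext j
    by_cases hj : j ∈ nbhd (M.netAt n c) i s
    · simp [truncTreat, hj, treatAt_congr c (huv j hj)]
    · simp [truncTreat, hj]
  rw [WTruncAt, WTruncAt, hi, hd]

theorem ExposureAssumption.expo_truncTreat {K : ℕ} (hE : M.ExposureAssumption K) {n : ℕ}
    (G : SimpleGraph (Fin n)) (i : Fin n) (d : Fin n → Bool) :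
    M.expo n G i (truncTreat G i K d) = M.expo n G i d :=
  hE.isLocal n G i _ _ fun j hj => by simp [truncTreat, hj]

theorem dist_WTruncAt_le {n : ℕ} (i : Fin n) (s : ℕ) (c : M.CommonShocks n)
    (u : Fin n → M.NodeShock n) :
    dist (M.WAt n i c u) (M.WTruncAt n i s c u) ≤
      |(M.WAt n i c u).1 - (M.WTruncAt n i s c u).1|
        + ‖(M.WAt n i c u).2.1 - (M.WTruncAt n i s c u).2.1‖ := by
  have hd : (M.WAt n i c u).2.2 = (M.WTruncAt n i s c u).2.2 := by
    simp [WAt, WTruncAt, pointAt, truncTreat_self]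
  rw [Prod.dist_eq, Prod.dist_eq, hd, dist_self, Real.dist_eq, dist_eq_norm]
  refine max_le (le_add_of_nonneg_right (norm_nonneg _)) (max_le ?_ (by positivity))
  exact le_add_of_nonneg_left (abs_nonneg _)

theorem WTruncAt_eq_WAt {K : ℕ} (hE : M.ExposureAssumption K) {n : ℕ} (i : Fin n)
    (c : M.CommonShocks n) : M.WTruncAt n i K c = M.WAt n i c := by
  funext u
  have h := hE.expo_truncTreat (M.netAt n c) i (M.treatAt n c u)
  have h' : M.level n (M.netAt n c) i (truncTreat (M.netAt n c) i K (M.treatAt n c u))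
      = M.level n (M.netAt n c) i (M.treatAt n c u) := Subtype.ext h
  simp only [WTruncAt, WAt, pointAt, h, h', truncTreat_self]

variable [MeasurableSpace Ω] {μ : Measure Ω}

/-- Mean-square deviation of the sample moments, given the common shocks. -/
theorem lintegral_sq_deviation_le (hM : M.IsMeasurable) (hlam : |M.lam| < 4) {K : ℕ}
    (hE : M.ExposureAssumption K) (t t' : Expo q) {β : Param kz kx} {B L : ℝ}
    (hB0 : 0 ≤ B) {n : ℕ} (hn : 0 < n) (hKn : 2 * K ≤ n) (c : M.CommonShocks n)
    (hBL : ∀ i x z w, (w, x, z) ∈ M.dataSupport μ n i (M.netAt n c) →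
      ‖moment t t' (M.netAt n c) i w x z β‖ ≤ B ∧
      ∀ w', (w', x, z) ∈ M.dataSupport μ n i (M.netAt n c) →
        ‖moment t t' (M.netAt n c) i w x z β - moment t t' (M.netAt n c) i w' x z β‖
          ≤ L * wDist w w')
    {ρ : Measure (Fin n → M.NodeShock n)} [IsProbabilityMeasure ρ]
    (hρ : iIndepFun (fun (i : Fin n) (u : Fin n → M.NodeShock n) => u i) ρ)
    (hsupp : ∀ i, ∀ᵐ u ∂ρ, M.dataAt n i (c, u) ∈ M.dataSupport μ n i (M.netAt n c)) :
    ∫⁻ u, ENNReal.ofReal (‖(n : ℝ)⁻¹ • ∑ i, M.gAt t t' n i β (c, u)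
        - (n : ℝ)⁻¹ • ∑ i, ∫ v, M.gAt t t' n i β (c, v) ∂ρ‖ ^ 2) ∂ρ ≤
      Fintype.card (PIdx kz kx) * ((n : ℝ≥0∞)⁻¹ * ENNReal.ofReal (2 * B * B)
        + ENNReal.ofReal (2 * B) * ((n : ℝ≥0∞)⁻¹ * ∑ s ∈ Finset.Icc 1 n,
          sphereAvg (M.netAt n c) s * (2 * (ENNReal.ofReal (2 * |L|) *
            ((⨆ i, ∫⁻ u, ENNReal.ofReal
                |(M.WAt n i c u).1 - (M.WTruncAt n i ((s - 1) / 4) c u).1| ∂ρ)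
              + ⨆ i, ∫⁻ u, ENNReal.ofReal
                ‖(M.WAt n i c u).2.1 - (M.WTruncAt n i ((s - 1) / 4) c u).2.1‖ ∂ρ))))) := by
  -- The moments are bounded and Lipschitz only on the support, which the truncated data may leave.
  -- They are replaced by extensions that agree with them at the actual data almost surely.
  have hext : ∀ i, ∃ h : WPoint q → PIdx kz kx → ℝ, (∀ a, Continuous fun w => h w a) ∧
      (∀ w a, |h w a| ≤ B) ∧ (∀ w w' a, |h w a - h w' a| ≤ 2 * |L| * dist w w') ∧
      ∀ w ∈ {w | (w, M.covAt n i c, M.exoAt n c) ∈ M.dataSupport μ n i (M.netAt n c)}, ∀ a,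
        h w a = moment t t' (M.netAt n c) i w (M.covAt n i c) (M.exoAt n c) β a := fun i =>
    exists_bounded_lipschitz_extension hB0 (fun w hw => (hBL i _ _ w hw).1)
      fun w hw w' hw' => (hBL i _ _ w hw).2 w' hw'
  choose h hcont hbdd hlip hS using hext
  have hW : ∀ i, Measurable (M.WAt n i c) := fun i =>
    (measurable_WAt hM hlam n i).comp measurable_prodMk_left
  have hWT : ∀ i s, Measurable (M.WTruncAt n i s c) := fun i s =>
    (measurable_WTruncAt hM hlam n i s).comp measurable_prodMk_left
  have hfm : ∀ a i, Measurable fun u => h i (M.WAt n i c u) a := fun a i =>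
    (hcont i a).measurable.comp (hW i)
  have hg : ∀ᵐ u ∂ρ, ∀ i a, M.gAt t t' n i β (c, u) a = h i (M.WAt n i c u) a := by
    filter_upwards [ae_all_iff.2 hsupp] with u hu i a using (hS i _ (hu i) a).symm
  have hgint : ∀ i, Integrable (fun v => M.gAt t t' n i β (c, v)) ρ := by
    intro i
    refine Integrable.of_eval_piLp fun a => ?_
    refine (Integrable.of_bound (hfm a i).aestronglyMeasurable B
      (ae_of_all _ fun u => hbdd i _ a)).congr ?_
    filter_upwards [hg] with u hu using (hu i a).symm
  have hEg : ∀ i a, (∫ v, M.gAt t t' n i β (c, v) ∂ρ) a = ∫ v, h i (M.WAt n i c v) a ∂ρ := by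
    intro i a
    rw [eval_integral_piLp fun b => (hgint i).eval_piLp b]
    refine integral_congr_ae ?_
    filter_upwards [hg] with u hu using hu i a
  have hvar : ∀ a, ENNReal.ofReal (Var[fun u => (n : ℝ)⁻¹ * ∑ i, h i (M.WAt n i c u) a; ρ]) ≤ _ :=
    fun a => ofReal_variance_average_le (M.netAt n c) hρ hn
      (f := fun i u => h i (M.WAt n i c u) a) (f' := fun r i u => h i (M.WTruncAt n i r c u) a)
      (hfm a) (fun r i => (hcont i a).measurable.comp (hWT i r)) (fun i u => hbdd i _ a)
      (fun r i u => hbdd i _ a)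
      (fun r i u v huv => by
        simp only [dependsOn_WTruncAt i r c huv])
      (K := K) (fun i => by simp only [WTruncAt_eq_WAt hE]) hKn
      (η := fun r => ENNReal.ofReal (2 * |L|) *
            ((⨆ i, ∫⁻ u, ENNReal.ofReal |(M.WAt n i c u).1 - (M.WTruncAt n i r c u).1| ∂ρ)
              + ⨆ i, ∫⁻ u, ENNReal.ofReal
                ‖(M.WAt n i c u).2.1 - (M.WTruncAt n i r c u).2.1‖ ∂ρ))
      (fun r i => by
        have hm1 : Measurable fun u => ENNReal.ofReal
            |(M.WAt n i c u).1 - (M.WTruncAt n i r c u).1| :=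
          (((hW i).fst.sub (hWT i r).fst).abs).ennreal_ofReal
        calc ∫⁻ u, ENNReal.ofReal |h i (M.WAt n i c u) a - h i (M.WTruncAt n i r c u) a| ∂ρ
            ≤ ∫⁻ u, ENNReal.ofReal (2 * |L|) *
                (ENNReal.ofReal |(M.WAt n i c u).1 - (M.WTruncAt n i r c u).1|
                + ENNReal.ofReal ‖(M.WAt n i c u).2.1 - (M.WTruncAt n i r c u).2.1‖) ∂ρ := by
              refine lintegral_mono fun u => ?_
              rw [← ENNReal.ofReal_add (abs_nonneg _) (norm_nonneg _),
                ← ENNReal.ofReal_mul (by positivity)]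
              refine ENNReal.ofReal_le_ofReal ((hlip i _ _ a).trans ?_)
              exact mul_le_mul_of_nonneg_left (dist_WTruncAt_le i r c u) (by positivity)
          _ ≤ _ := by
              rw [lintegral_const_mul' _ _ ENNReal.ofReal_ne_top, lintegral_add_left hm1]
              gcongr
              · exact le_iSup (fun i => ∫⁻ u, ENNReal.ofReal
                  |(M.WAt n i c u).1 - (M.WTruncAt n i r c u).1| ∂ρ) i
              · exact le_iSup (fun i => ∫⁻ u, ENNReal.ofReal
                  ‖(M.WAt n i c u).2.1 - (M.WTruncAt n i r c u).2.1‖ ∂ρ) i)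
  have hsplit : ∫⁻ u, ENNReal.ofReal (‖(n : ℝ)⁻¹ • ∑ i, M.gAt t t' n i β (c, u)
        - (n : ℝ)⁻¹ • ∑ i, ∫ v, M.gAt t t' n i β (c, v) ∂ρ‖ ^ 2) ∂ρ
      = ∑ a, ENNReal.ofReal (Var[fun u => (n : ℝ)⁻¹ * ∑ i, h i (M.WAt n i c u) a; ρ]) := by
    have hfint : ∀ a i, Integrable (fun u => h i (M.WAt n i c u) a) ρ := fun a i =>
      Integrable.of_bound (hfm a i).aestronglyMeasurable B (ae_of_all _ fun u => hbdd i _ a)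
    have hL2' : ∀ a i, MemLp (fun u => h i (M.WAt n i c u) a) 2 ρ := fun a i =>
      MemLp.of_bound (hfm a i).aestronglyMeasurable B (ae_of_all _ fun u => hbdd i _ a)
    have hsum : ∀ a, MemLp (fun u => ∑ i, h i (M.WAt n i c u) a) 2 ρ := fun a =>
      memLp_finsetSum (f := fun i u => h i (M.WAt n i c u) a) Finset.univ fun i _ => hL2' a i
    have hL2 : ∀ a, MemLp (fun u => (n : ℝ)⁻¹ * ∑ i, h i (M.WAt n i c u) a) 2 ρ := fun a =>
      (hsum a).const_mul _
    have hmean : ∀ a, ∫ u, (n : ℝ)⁻¹ * ∑ i, h i (M.WAt n i c u) a ∂ρ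
        = (n : ℝ)⁻¹ * ∑ i, ∫ u, h i (M.WAt n i c u) a ∂ρ := fun a => by
      rw [integral_const_mul, integral_finsetSum _ fun i _ => hfint a i]
    refine lintegral_sq_norm_sub_mean hL2 ?_ fun a => ?_
    · filter_upwards [hg] with u hu a
      simp [hu]
    · rw [hmean]
      simp [hEg]
  rw [hsplit]
  refine (Finset.sum_le_sum fun a _ => hvar a).trans_eq ?_
  rw [Finset.sum_const, nsmul_eq_mul, Finset.card_univ]

end NetworkModel

/-- Together with `ofReal_le_ofReal_add_sq`, this replaces the Cauchy–Schwarz step from mean squares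
to means. -/
theorem tendsto_zero_of_le_ofReal_add {a b : ℕ → ℝ≥0∞} (hb : Tendsto b atTop (𝓝 0))
    (h : ∀ δ : ℝ, 0 < δ → ∀ᶠ n in atTop,
      a n ≤ ENNReal.ofReal δ + ENNReal.ofReal δ⁻¹ * b n) : Tendsto a atTop (𝓝 0) := by
  rw [ENNReal.tendsto_nhds_zero]
  intro ε hε
  obtain ⟨δ, hδ0, hδ⟩ : ∃ δ : ℝ, 0 < δ ∧ ENNReal.ofReal δ ≤ ε / 2 := by
    obtain ⟨r, hr0, hr⟩ := ENNReal.lt_iff_exists_real_btwn.1 (ENNReal.half_pos hε.ne')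
    refine ⟨r, ?_, hr.2.le⟩
    exact ENNReal.ofReal_pos.1 hr.1
  have h1 : Tendsto (fun n => ENNReal.ofReal δ⁻¹ * b n) atTop (𝓝 0) := by
    simpa using ENNReal.Tendsto.const_mul hb (Or.inr ENNReal.ofReal_ne_top)
  filter_upwards [h δ hδ0, ENNReal.tendsto_nhds_zero.1 h1 _ (ENNReal.half_pos hε.ne')] with n h2 h3
  calc a n ≤ ε / 2 + ε / 2 := h2.trans (add_le_add hδ h3)
    _ = ε := ENNReal.add_halves ε

/-- Expand `δ⁻¹ (x - δ)² ≥ 0`. -/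
theorem ofReal_le_ofReal_add_sq {x δ : ℝ} (hδ : 0 < δ) :
    ENNReal.ofReal x ≤ ENNReal.ofReal δ + ENNReal.ofReal δ⁻¹ * ENNReal.ofReal (x ^ 2) := by
  rw [← ENNReal.ofReal_mul (by positivity), ← ENNReal.ofReal_add hδ.le (by positivity)]
  refine ENNReal.ofReal_le_ofReal ?_
  have : 0 ≤ δ⁻¹ * (x - δ) ^ 2 := by positivity
  have h2 : δ⁻¹ * (x - δ) ^ 2 = δ⁻¹ * x ^ 2 - 2 * x + δ := by field_simp; ring
  have h3 : 0 ≤ δ⁻¹ * x ^ 2 := by positivity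
  by_cases hx : 0 ≤ x <;> linarith

theorem norm_average_le {n : ℕ} {E : Type*} [NormedAddCommGroup E] [NormedSpace ℝ E]
    {v : Fin n → E} {b : ℝ} (hb : 0 ≤ b) (hv : ∀ i, ‖v i‖ ≤ b) :
    ‖(n : ℝ)⁻¹ • ∑ i, v i‖ ≤ b := by
  rw [norm_smul, norm_inv, Real.norm_natCast]
  have h1 : ‖∑ i, v i‖ ≤ n * b := by
    simpa using norm_sum_le_of_le Finset.univ fun i _ => hv i
  rcases Nat.eq_zero_or_pos n with h0 | h0
  · subst h0; simpa using hb
  · have : (0 : ℝ) < n := by exact_mod_cast h0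
    rw [inv_mul_le_iff₀ this]
    exact h1

namespace NetworkModel

variable {Ω : Type*} {kz kx q : ℕ} {M : NetworkModel Ω kz kx q} [MeasurableSpace Ω]
  {μ : Measure Ω}

theorem ae_norm_g_le {t t' : Expo q} {β : Param kz kx} {B : ℝ} (hM : M.IsMeasurable)
    (hlam : |M.lam| < 4)
    (hB : ∀ n i G x z w, (w, x, z) ∈ M.dataSupport μ n i G → ‖moment t t' G i w x z β‖ ≤ B)
    {n : ℕ} (i : Fin n) : ∀ᵐ ω ∂μ, ‖M.g t t' n i β ω‖ ≤ B := by
  filter_upwards [ae_mem_dataSupport hM hlam n i] with ω hω using hB n i _ _ _ _ hω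

variable [IsProbabilityMeasure μ]

variable (M μ) in
/-- The regular conditional distribution of the shocks of the nodes given the common shocks. -/
def shockKernel (n : ℕ) : Kernel (M.CommonShocks n) (Fin n → M.NodeShock n) :=
  condDistrib (M.nodeShocks n) (M.toCommon n) μ

instance (n : ℕ) : IsMarkovKernel (M.shockKernel μ n) :=
  inferInstanceAs (IsMarkovKernel (condDistrib _ _ _))

theorem condLExp_ae_eq_lintegral_shockKernel (hM : M.IsMeasurable) {n : ℕ}
    {F : M.CommonShocks n × (Fin n → M.NodeShock n) → ℝ≥0∞} (hF : Measurable F) :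
    condLExp (M.C n) μ (fun ω => F (M.toCommon n ω, M.nodeShocks n ω)) =ᵐ[μ]
      fun ω => ∫⁻ u, F (M.toCommon n ω, u) ∂M.shockKernel μ n (M.toCommon n ω) := by
  have h := condLExp_ae_eq_lintegral_condDistrib (μ := μ) (measurable_toCommon hM n)
    (measurable_nodeShocks hM n) hF
  rwa [comap_toCommon] at h

/-- The population moments in terms of the conditional distribution of the shocks. -/
theorem condExp_g_ae_eq (hM : M.IsMeasurable) (hlam : |M.lam| < 4) (t t' : Expo q) {n : ℕ}
    (i : Fin n) {β : Param kz kx} (hβ : |paramLam β| < 4)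
    (h_int : Integrable (M.g t t' n i β) μ) :
    μ[M.g t t' n i β | M.C n] =ᵐ[μ] fun ω =>
      ∫ u, M.gAt t t' n i β (M.toCommon n ω, u) ∂M.shockKernel μ n (M.toCommon n ω) := by
  have h := condExp_prod_ae_eq_integral_condDistrib (μ := μ) (measurable_toCommon hM n)
    (measurable_nodeShocks hM n).aemeasurable
    (measurable_gAt hM hlam t t' n i hβ).stronglyMeasurable h_int
  rwa [comap_toCommon] at h

section Bounded

variable {t t' : Expo q} {β : Param kz kx} {B : ℝ}

theorem integrable_g (hM : M.IsMeasurable) (hlam : |M.lam| < 4) (hβ : |paramLam β| < 4)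
    (hB : ∀ n i G x z w, (w, x, z) ∈ M.dataSupport μ n i G → ‖moment t t' G i w x z β‖ ≤ B)
    {n : ℕ} (i : Fin n) : Integrable (M.g t t' n i β) μ :=
  Integrable.of_bound ((measurable_gAt hM hlam t t' n i hβ).comp
    (measurable_nodeData hM n)).aestronglyMeasurable B (ae_norm_g_le hM hlam hB i)

theorem ae_ae_mem_dataSupport (hM : M.IsMeasurable) (hlam : |M.lam| < 4) (n : ℕ) (i : Fin n) :
    ∀ᵐ ω ∂μ, ∀ᵐ u ∂M.shockKernel μ n (M.toCommon n ω), M.dataAt n i (M.toCommon n ω, u)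
      ∈ M.dataSupport μ n i (M.netAt n (M.toCommon n ω)) :=
  ae_ae_condDistrib (measurable_toCommon hM n) (measurable_nodeShocks hM n)
    (measurableSet_dataAt_mem hM hlam n i) (ae_mem_dataSupport hM hlam n i)

theorem ae_norm_gPop_le (hM : M.IsMeasurable) (hlam : |M.lam| < 4) (hβ : |paramLam β| < 4)
    (hB0 : 0 ≤ B)
    (hB : ∀ n i G x z w, (w, x, z) ∈ M.dataSupport μ n i G → ‖moment t t' G i w x z β‖ ≤ B)
    (n : ℕ) : ∀ᵐ ω ∂μ, ‖M.gPop μ t t' n β ω‖ ≤ B := by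
  filter_upwards [ae_all_iff.2 fun i => condExp_g_ae_eq hM hlam t t' (n := n) i hβ
      (integrable_g hM hlam hβ hB i), ae_all_iff.2 fun i => ae_ae_mem_dataSupport hM hlam n i]
    with ω h1 h2
  refine norm_average_le hB0 fun i => ?_
  rw [h1 i]
  have := norm_integral_le_of_norm_le_const (μ := M.shockKernel μ n (M.toCommon n ω))
    (f := fun u => M.gAt t t' n i β (M.toCommon n ω, u)) (C := B)
    (by filter_upwards [h2 i] with u hu using hB n i _ _ _ _ hu)
  simpa using this

end Bounded

variable (M μ) in
/-- The distance of the sample moments from their mean given the common shocks. -/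
def deviation (t t' : Expo q) (n : ℕ) (β : Param kz kx)
    (p : M.CommonShocks n × (Fin n → M.NodeShock n)) : ℝ :=
  ‖(n : ℝ)⁻¹ • ∑ i, M.gAt t t' n i β p
    - (n : ℝ)⁻¹ • ∑ i, ∫ v, M.gAt t t' n i β (p.1, v) ∂M.shockKernel μ n p.1‖

theorem measurable_deviation (hM : M.IsMeasurable) (hlam : |M.lam| < 4) (t t' : Expo q) {n : ℕ}
    {β : Param kz kx} (hβ : |paramLam β| < 4) : Measurable (M.deviation μ t t' n β) := by
  have h1 : ∀ i, Measurable (M.gAt t t' n i β) := fun i => measurable_gAt hM hlam t t' n i hβ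
  have h2 : ∀ i, Measurable fun c => ∫ v, M.gAt t t' n i β (c, v) ∂M.shockKernel μ n c :=
    fun i => (h1 i).stronglyMeasurable.integral_condDistrib.measurable
  have h3 : Measurable fun p => ∑ i, M.gAt t t' n i β p :=
    Finset.measurable_sum _ fun i _ => h1 i
  have h4 : Measurable fun c => ∑ i, ∫ v, M.gAt t t' n i β (c, v) ∂M.shockKernel μ n c :=
    Finset.measurable_sum _ fun i _ => h2 i
  exact ((h3.const_smul (n : ℝ)⁻¹).sub ((h4.comp measurable_fst).const_smul (n : ℝ)⁻¹)).norm

/-- Law of large numbers for the sample moments, conditionally on the common shocks. -/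
theorem tendsto_condLExp_norm_gHat_sub_gPop (hM : M.IsMeasurable) (hS : M.ShockAssumption μ)
    {K : ℕ} (hE : M.ExposureAssumption K) {t t' : Expo q} {Θ : Set (Param kz kx)}
    (hR : M.RegularityLLN μ t t' Θ) (hlam : |M.lam| < 4) {β : Param kz kx} (hβΘ : β ∈ Θ) :
    ∀ᵐ ω ∂μ, Tendsto (fun n => condLExp (M.C n) μ
      (fun ω' => ENNReal.ofReal ‖M.gHat t t' n β ω' - M.gPop μ t t' n β ω'‖) ω) atTop (𝓝 0) := by
  have hβ := hR.peer β hβΘ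
  obtain ⟨B₀, L, hBL₀⟩ := hR.boundedLipschitz β hβΘ
  -- The assumed bound need not be nonnegative where the support is empty.
  set B := max B₀ 0
  have hB0 : 0 ≤ B := le_max_right _ _
  have hB : ∀ n i G x z w, (w, x, z) ∈ M.dataSupport μ n i G → ‖moment t t' G i w x z β‖ ≤ B :=
    fun n i G x z w h => (hBL₀ n i G x z w h).1.trans (le_max_left _ _)
  have hrep : ∀ n, condLExp (M.C n) μ
      (fun ω' => ENNReal.ofReal ‖M.gHat t t' n β ω' - M.gPop μ t t' n β ω'‖) =ᵐ[μ]
      fun ω => ∫⁻ u, ENNReal.ofReal (M.deviation μ t t' n β (M.toCommon n ω, u))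
        ∂M.shockKernel μ n (M.toCommon n ω) := by
    intro n
    refine EventuallyEq.trans (condLExp_congr_ae ?_)
      (condLExp_ae_eq_lintegral_shockKernel hM
        (measurable_deviation hM hlam t t' hβ).ennreal_ofReal)
    filter_upwards [ae_all_iff.2 fun i => condExp_g_ae_eq hM hlam t t' (n := n) i hβ
      (integrable_g hM hlam hβ hB i)] with ω h1
    simp only [gHat, gPop, deviation, h1]
    rfl
  have hYrep : ∀ n (i : Fin n) r, condLExp (M.C n) μ
      (fun ω' => ENNReal.ofReal |M.Y n i ω' - M.YTrunc n i r ω'|) =ᵐ[μ] fun ω =>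
      ∫⁻ u, ENNReal.ofReal |(M.WAt n i (M.toCommon n ω) u).1
        - (M.WTruncAt n i r (M.toCommon n ω) u).1| ∂M.shockKernel μ n (M.toCommon n ω) :=
    fun n i r => condLExp_ae_eq_lintegral_shockKernel hM
      (F := fun p => ENNReal.ofReal |(M.WAt n i p.1 p.2).1 - (M.WTruncAt n i r p.1 p.2).1|)
      (((measurable_WAt hM hlam n i).fst.sub
        (measurable_WTruncAt hM hlam n i r).fst).abs).ennreal_ofReal
  have hTrep : ∀ n (i : Fin n) r, condLExp (M.C n) μ
      (fun ω' => ENNReal.ofReal ‖M.T n i ω' - M.TTrunc n i r ω'‖) =ᵐ[μ] fun ω =>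
      ∫⁻ u, ENNReal.ofReal ‖(M.WAt n i (M.toCommon n ω) u).2.1
        - (M.WTruncAt n i r (M.toCommon n ω) u).2.1‖ ∂M.shockKernel μ n (M.toCommon n ω) :=
    fun n i r => condLExp_ae_eq_lintegral_shockKernel hM
      (F := fun p => ENNReal.ofReal ‖(M.WAt n i p.1 p.2).2.1 - (M.WTruncAt n i r p.1 p.2).2.1‖)
      (((measurable_WAt hM hlam n i).snd.fst.sub
        (measurable_WTruncAt hM hlam n i r).snd.fst).norm).ennreal_ofReal
  have hind : ∀ n, ∀ᵐ ω ∂μ, iIndepFun (fun (i : Fin n) (u : Fin n → M.NodeShock n) => u i)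
      (M.shockKernel μ n (M.toCommon n ω)) := fun n =>
    iIndepFun_condDistrib (measurable_toCommon hM n) (measurable_nodeShocks hM n)
      (by rw [comap_toCommon]; exact condIndepFamily_nodeShocks hS n)
  filter_upwards [hR.decay, ae_all_iff.2 hrep, ae_all_iff.2 hind,
    ae_all_iff.2 fun n => ae_all_iff.2 fun i => ae_all_iff.2 fun r => hYrep n i r,
    ae_all_iff.2 fun n => ae_all_iff.2 fun i => ae_all_iff.2 fun r => hTrep n i r,
    ae_all_iff.2 fun n => ae_all_iff.2 fun i => ae_ae_mem_dataSupport hM hlam n i]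
    with ω hdecay hrep hind hYrep hTrep hsupp
  set b : ℕ → ℝ≥0∞ := fun n => Fintype.card (PIdx kz kx) * ((n : ℝ≥0∞)⁻¹ *
    ENNReal.ofReal (2 * B * B) + ENNReal.ofReal (2 * B) * (ENNReal.ofReal (2 * |L|) *
      ((n : ℝ≥0∞)⁻¹ * ∑ s ∈ Finset.Icc 1 n, sphereAvg (M.A n ω) s * M.psiCoeff μ n s ω)))
  have hb : Tendsto b atTop (𝓝 0) := by
    have h1 : Tendsto (fun n : ℕ => (n : ℝ≥0∞)⁻¹ * ENNReal.ofReal (2 * B * B)) atTop (𝓝 0) := by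
      simpa using ENNReal.Tendsto.mul_const ENNReal.tendsto_inv_nat_nhds_zero
        (Or.inr (ENNReal.ofReal_ne_top (r := 2 * B * B)))
    have h2 := ENNReal.Tendsto.const_mul (ENNReal.Tendsto.const_mul hdecay
      (Or.inr (ENNReal.ofReal_ne_top (r := 2 * |L|)))) (Or.inr (ENNReal.ofReal_ne_top (r := 2 * B)))
    have h3 := ENNReal.Tendsto.const_mul (h1.add h2)
      (Or.inr (ENNReal.natCast_ne_top (Fintype.card (PIdx kz kx))))
    simp only [mul_zero, add_zero] at h3
    exact h3
  refine tendsto_zero_of_le_ofReal_add hb fun δ hδ => ?_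
  filter_upwards [eventually_gt_atTop 0, eventually_ge_atTop (2 * K)] with n hn hKn
  rw [hrep n]
  calc ∫⁻ u, ENNReal.ofReal (M.deviation μ t t' n β (M.toCommon n ω, u))
        ∂M.shockKernel μ n (M.toCommon n ω)
      ≤ ∫⁻ u, ENNReal.ofReal δ + ENNReal.ofReal δ⁻¹ *
          ENNReal.ofReal (M.deviation μ t t' n β (M.toCommon n ω, u) ^ 2)
            ∂M.shockKernel μ n (M.toCommon n ω) :=
        lintegral_mono fun u => ofReal_le_ofReal_add_sq hδ
    _ = ENNReal.ofReal δ + ENNReal.ofReal δ⁻¹ * ∫⁻ u,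
          ENNReal.ofReal (M.deviation μ t t' n β (M.toCommon n ω, u) ^ 2)
            ∂M.shockKernel μ n (M.toCommon n ω) := by
        rw [lintegral_add_left measurable_const, lintegral_const_mul' _ _ ENNReal.ofReal_ne_top]
        simp
    _ ≤ ENNReal.ofReal δ + ENNReal.ofReal δ⁻¹ * b n := by
        gcongr
        refine (lintegral_sq_deviation_le hM hlam hE t t' hB0 hn hKn (M.toCommon n ω)
          (L := L) (fun i x z w hw => ⟨hB n i _ x z w hw, (hBL₀ n i _ x z w hw).2⟩)
          (hind n) (hsupp n)).trans ?_
        simp only [b]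
        refine mul_le_mul' le_rfl (add_le_add le_rfl (mul_le_mul' le_rfl ?_))
        rw [mul_left_comm (ENNReal.ofReal (2 * |L|))]
        refine mul_le_mul' le_rfl ?_
        rw [Finset.mul_sum]
        refine Finset.sum_le_sum fun s _ => ?_
        rw [mul_left_comm (2 : ℝ≥0∞), mul_left_comm (sphereAvg _ s)]
        refine mul_le_mul' le_rfl (mul_le_mul' le_rfl ?_)
        -- The outcome and exposure terms suffice, because truncation leaves the node's own
        -- treatment unchanged; the `thetaD` term of `thetaW` only enlarges the bound.
        simp only [psiCoeff, thetaW, hYrep, hTrep]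
        exact le_self_add

end NetworkModel

/-! ### Quadratic forms and the Frobenius norm -/

section Frobenius

variable {ι : Type*} [Fintype ι]

theorem frob_eq_norm (A : Matrix ι ι ℝ) :
    frob A = ‖(WithLp.toLp 2 fun p : ι × ι => A p.1 p.2 : EuclideanSpace ℝ (ι × ι))‖ := by
  rw [frob, EuclideanSpace.norm_eq, Fintype.sum_prod_type_right]
  simp [Matrix.trace, Matrix.mul_apply, sq]

theorem frob_nonneg (A : Matrix ι ι ℝ) : 0 ≤ frob A := Real.sqrt_nonneg _

theorem frob_le_add_frob_sub (A A' : Matrix ι ι ℝ) : frob A ≤ frob (A' - A) + frob A' := by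
  simp only [frob_eq_norm]
  refine (norm_le_norm_sub_add _ (WithLp.toLp 2 fun p : ι × ι => A' p.1 p.2)).trans_eq ?_
  rw [norm_sub_rev]
  rfl

theorem measurable_frob {α : Type*} {_ : MeasurableSpace α} {A : α → Matrix ι ι ℝ}
    (hA : ∀ i j, Measurable fun a => A a i j) : Measurable fun a => frob (A a) := by
  simp only [frob, Matrix.trace, Matrix.diag_apply, Matrix.mul_apply, Matrix.transpose_apply]
  fun_prop

theorem measurable_quad {α : Type*} {_ : MeasurableSpace α} {A : α → Matrix ι ι ℝ}
    {v : α → EuclideanSpace ℝ ι} (hA : ∀ i j, Measurable fun a => A a i j) (hv : Measurable v) :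
    Measurable fun a => quad (A a) (v a) := by
  have hv' : ∀ i, Measurable fun a => v a i := fun i => by fun_prop
  simp only [quad]
  fun_prop

/-- Cauchy–Schwarz over index pairs, applied to `A` and the array `u a * v b`, whose norm is `‖u‖ *
‖v‖`. -/
theorem abs_bilin_le (A : Matrix ι ι ℝ) (u v : EuclideanSpace ℝ ι) :
    |∑ a, ∑ b, u a * A a b * v b| ≤ frob A * (‖u‖ * ‖v‖) := by
  have h1 : ∑ a, ∑ b, u a * A a b * v b = ∑ p : ι × ι, A p.1 p.2 * (u p.1 * v p.2) := by
    rw [Fintype.sum_prod_type]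
    exact Finset.sum_congr rfl fun a _ => Finset.sum_congr rfl fun b _ => by ring
  have h2 : ∑ p : ι × ι, (u p.1 * v p.2) ^ 2 = (‖u‖ * ‖v‖) ^ 2 := by
    rw [mul_pow, EuclideanSpace.norm_sq_eq, EuclideanSpace.norm_sq_eq, Finset.sum_mul_sum,
      Fintype.sum_prod_type]
    simp [mul_pow]
  have h3 : ∑ p : ι × ι, A p.1 p.2 ^ 2 = frob A ^ 2 := by
    rw [frob_eq_norm, EuclideanSpace.norm_sq_eq]
    simp
  rw [h1]
  refine abs_le_of_sq_le_sq ?_ (by have := frob_nonneg A; positivity)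
  rw [mul_pow, ← h2, ← h3]
  exact Finset.sum_mul_sq_le_sq_mul_sq _ _ _

theorem abs_quad_le (A : Matrix ι ι ℝ) (v : EuclideanSpace ℝ ι) :
    |quad A v| ≤ frob A * ‖v‖ ^ 2 := by
  rw [sq]; exact abs_bilin_le A v v

theorem quad_le_quad_add (A : Matrix ι ι ℝ) {u v : EuclideanSpace ℝ ι} {B : ℝ} (hu : ‖u‖ ≤ B)
    (hv : ‖v‖ ≤ B) : quad A u ≤ quad A v + frob A * (2 * B * ‖u - v‖) := by
  have h : quad A u - quad A v = (∑ a, ∑ b, (u - v) a * A a b * u b)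
      + ∑ a, ∑ b, v a * A a b * (u - v) b := by
    simp only [quad, ← Finset.sum_add_distrib, ← Finset.sum_sub_distrib, PiLp.sub_apply]
    exact Finset.sum_congr rfl fun a _ => Finset.sum_congr rfl fun b _ => by ring
  have h1 := (le_abs_self _).trans (abs_bilin_le A (u - v) u)
  have h2 := (le_abs_self _).trans (abs_bilin_le A v (u - v))
  have h3 : frob A * (‖u - v‖ * ‖u‖) ≤ frob A * (‖u - v‖ * B) := by
    have := frob_nonneg A; gcongr
  have h4 : frob A * (‖v‖ * ‖u - v‖) ≤ frob A * (B * ‖u - v‖) := by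
    have := frob_nonneg A; gcongr
  linarith

theorem quad_le_quad_add_frob_sub (A A' : Matrix ι ι ℝ) {v : EuclideanSpace ℝ ι} {B : ℝ}
    (hv : ‖v‖ ≤ B) :
    quad A v ≤ quad A' v + frob (A' - A) * B ^ 2 ∧
      quad A' v ≤ quad A v + frob (A' - A) * B ^ 2 := by
  have h : quad A' v - quad A v = quad (A' - A) v := by
    simp only [quad, ← Finset.sum_sub_distrib, Matrix.sub_apply]
    exact Finset.sum_congr rfl fun a _ => Finset.sum_congr rfl fun b _ => by ring
  have h1 := abs_le.1 ((abs_quad_le (A' - A) v).trans (mul_le_mul_of_nonneg_left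
    (pow_le_pow_left₀ (norm_nonneg v) hv 2) (frob_nonneg _)))
  constructor <;> linarith [h1.1, h1.2]

/-- The population objective at a point `k` near a minimiser `h` of the sample objective. -/
theorem quad_le_of_quad_le {A A' : Matrix ι ι ℝ} {g gk gh g0 p0 : EuclideanSpace ℝ ι} {B d : ℝ}
    (hg : ‖g‖ ≤ B) (hgk : ‖gk‖ ≤ B) (hgh : ‖gh‖ ≤ B) (hg0 : ‖g0‖ ≤ B) (hp0 : p0 = 0)
    (hd : ‖gk - gh‖ ≤ d) (hmin : quad A' gh ≤ quad A' g0) :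
    quad A g - frob A * (2 * B * d) ≤
      frob A * (2 * B * ‖gk - g‖ + B * ‖g0 - p0‖) + 2 * B ^ 2 * frob (A' - A) := by
  have hB0 : 0 ≤ B := (norm_nonneg _).trans hg
  have hA := frob_nonneg A
  have e1 := quad_le_quad_add A hg hgk
  -- The chain runs from the population moment `g` through the sample moments `gk` at the same
  -- parameter and `gh` at the estimator, then, after exchanging `A` for `A'`, by minimality to
  -- `g0`, and back to `A`. Each of the two exchanges costs `B ^ 2 * frob (A' - A)`.
  have e2 := quad_le_quad_add A hgk hgh
  have e3 := (quad_le_quad_add_frob_sub A A' hgh).1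
  have e4 := (quad_le_quad_add_frob_sub A A' hg0).2
  have e5 := (le_abs_self _).trans (abs_quad_le A g0)
  have e6 : frob A * ‖g0‖ ^ 2 ≤ frob A * (B * ‖g0‖) := by rw [sq]; gcongr
  have e7 : frob A * (2 * B * ‖gk - gh‖) ≤ frob A * (2 * B * d) := by gcongr
  rw [norm_sub_rev] at e1
  rw [hp0, sub_zero]
  linarith

end Frobenius

namespace NetworkModel

variable {Ω : Type*} {kz kx q : ℕ} {M : NetworkModel Ω kz kx q} [MeasurableSpace Ω]
  {μ : Measure Ω}

/-! ### Consistency -/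

/-- The moments are bounded on the support, uniformly over the parameter space. -/
theorem RegularityLLN.exists_uniform_bound {t t' : Expo q} {Θ : Set (Param kz kx)}
    (hR : M.RegularityLLN μ t t' Θ) {β₀ : Param kz kx} (hβ₀ : β₀ ∈ Θ) :
    ∃ B : ℝ, 0 ≤ B ∧ ∀ β ∈ Θ, ∀ n i G x z w, (w, x, z) ∈ M.dataSupport μ n i G →
      ‖moment t t' G i w x z β‖ ≤ B := by
  obtain ⟨B, _, hB⟩ := hR.boundedLipschitz β₀ hβ₀
  obtain ⟨L, hL0, hL⟩ := hR.equicontinuous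
  obtain ⟨R, hR⟩ := hR.compact.isBounded.subset_closedBall β₀
  -- The bound at `β₀` plus the Lipschitz constant times a radius of `Θ` around `β₀`.
  refine ⟨max B 0 + L * max R 0, by positivity, fun β hβ n i G x z w hw => ?_⟩
  have h1 := (hB n i G x z w hw).1
  have h2 := hL n i G x z w hw β hβ β₀ hβ₀
  have h3 : ‖β - β₀‖ ≤ max R 0 := by
    rw [← dist_eq_norm]; exact (hR hβ).trans (le_max_left _ _)
  calc ‖moment t t' G i w x z β‖
      ≤ ‖moment t t' G i w x z β - moment t t' G i w x z β₀‖ + ‖moment t t' G i w x z β₀‖ :=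
        norm_le_norm_sub_add _ _
    _ ≤ L * max R 0 + max B 0 :=
        add_le_add (h2.trans (mul_le_mul_of_nonneg_left h3 hL0.le)) (h1.trans (le_max_left _ _))
    _ = _ := add_comm _ _

/-- The sample moments are bounded and Lipschitz on the parameter space. -/
theorem ae_gHat_bounded_lipschitz (hM : M.IsMeasurable) (hlam : |M.lam| < 4) {t t' : Expo q}
    {Θ : Set (Param kz kx)} {B L : ℝ} (hB0 : 0 ≤ B) (hL0 : 0 ≤ L)
    (hB : ∀ β ∈ Θ, ∀ n i G x z w, (w, x, z) ∈ M.dataSupport μ n i G →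
      ‖moment t t' G i w x z β‖ ≤ B)
    (hL : ∀ n i G x z w, (w, x, z) ∈ M.dataSupport μ n i G → ∀ β ∈ Θ, ∀ β' ∈ Θ,
      ‖moment t t' G i w x z β - moment t t' G i w x z β'‖ ≤ L * ‖β - β'‖) (n : ℕ) :
    ∀ᵐ ω ∂μ, (∀ β ∈ Θ, ‖M.gHat t t' n β ω‖ ≤ B) ∧ ∀ β ∈ Θ, ∀ β' ∈ Θ,
      ‖M.gHat t t' n β ω - M.gHat t t' n β' ω‖ ≤ L * ‖β - β'‖ := by
  filter_upwards [ae_all_iff.2 fun i => ae_mem_dataSupport (μ := μ) hM hlam n i] with ω hω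
  refine ⟨fun β hβ => norm_average_le hB0 fun i => hB β hβ n i _ _ _ _ (hω i),
    fun β hβ β' hβ' => ?_⟩
  rw [gHat, gHat, ← smul_sub, ← Finset.sum_sub_distrib]
  exact norm_average_le (by positivity) fun i => hL n i _ _ _ _ (hω i) β hβ β' hβ'

theorem measurable_g (hM : M.IsMeasurable) (hlam : |M.lam| < 4) (t t' : Expo q) (n : ℕ)
    (i : Fin n) {β : Param kz kx} (hβ : |paramLam β| < 4) : Measurable (M.g t t' n i β) :=
  Measurable.comp (g := M.gAt t t' n i β) (f := fun ω => (M.toCommon n ω, M.nodeShocks n ω))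
    (measurable_gAt hM hlam t t' n i hβ) (measurable_nodeData hM n)

theorem measurable_gHat (hM : M.IsMeasurable) (hlam : |M.lam| < 4) (t t' : Expo q) (n : ℕ)
    {β : Param kz kx} (hβ : |paramLam β| < 4) : Measurable (M.gHat t t' n β) := by
  have h2 : Measurable fun ω => ∑ i, M.g t t' n i β ω :=
    Finset.measurable_sum _ fun i _ => measurable_g hM hlam t t' n i hβ
  exact h2.const_smul (n : ℝ)⁻¹

theorem measurable_gPop (t t' : Expo q) (n : ℕ) (β : Param kz kx) :
    Measurable[M.C n] (M.gPop μ t t' n β) := by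
  have h1 : ∀ i, Measurable[M.C n] (μ[M.g t t' n i β | M.C n]) := fun i =>
    stronglyMeasurable_condExp.measurable
  have h2 : Measurable[M.C n] fun ω => ∑ i, (μ[M.g t t' n i β | M.C n]) ω :=
    Finset.measurable_sum _ fun i _ => h1 i
  exact h2.const_smul (n : ℝ)⁻¹

variable [IsProbabilityMeasure μ]

/-- The Frobenius norms of the population weights are almost surely bounded. -/
theorem WeightAssumption.ae_eventually_frob_le (hM : M.IsMeasurable)
    {Xihat Xi : ℕ → Ω → Matrix (PIdx kz kx) (PIdx kz kx) ℝ}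
    (hW : M.WeightAssumption μ Xihat Xi) :
    ∀ᵐ ω ∂μ, ∃ R : ℝ, ∀ᶠ n in atTop, frob (Xi n ω) ≤ R := by
  have key : ∀ n, ∀ᵐ ω ∂μ, ENNReal.ofReal (frob (Xi n ω)) ≤
      condLExp (M.C n) μ (fun ω' => ENNReal.ofReal (frob (Xihat n ω' - Xi n ω'))) ω
        + condLExp (M.C n) μ (fun ω' => ENNReal.ofReal (frob (Xihat n ω'))) ω := by
    intro n
    have hXi : Measurable[M.C n] fun ω => ENNReal.ofReal (frob (Xi n ω)) :=
      (measurable_frob (hW.measurable_pop n)).ennreal_ofReal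
    have hXihat : Measurable fun ω => ENNReal.ofReal (frob (Xihat n ω)) :=
      (measurable_frob (hW.measurable_hat n)).ennreal_ofReal
    have h1 := condLExp_mono (mΩ := M.C n) (P := μ)
      (X := fun ω => ENNReal.ofReal (frob (Xi n ω)))
      (Y := (fun ω => ENNReal.ofReal (frob (Xihat n ω - Xi n ω)))
        + fun ω => ENNReal.ofReal (frob (Xihat n ω)))
      (ae_of_all _ fun ω => by
        simp only [Pi.add_apply]
        rw [← ENNReal.ofReal_add (frob_nonneg _) (frob_nonneg _)]
        exact ENNReal.ofReal_le_ofReal (frob_le_add_frob_sub _ _))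
    have h2 := condLExp_add_right (mΩ := M.C n) (P := μ)
      (fun ω => ENNReal.ofReal (frob (Xihat n ω - Xi n ω))) hXihat.aemeasurable
    filter_upwards [h1, h2] with ω h1 h2
    -- `Xi n` is `C n`-measurable, so the conditional bound on its norm is a pointwise one.
    rw [h2, condLExp_eq_self (hM.le n) μ hXi] at h1
    exact h1
  filter_upwards [ae_all_iff.2 key, hW.bounded, hW.tendsto] with ω h1 h2 h3
  set S := ⨆ n : ℕ, ⨆ _ : 1 ≤ n,
    condLExp (M.C n) μ (fun ω' => ENNReal.ofReal (frob (Xihat n ω'))) ω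
  refine ⟨(1 + S).toReal, ?_⟩
  filter_upwards [ENNReal.tendsto_nhds_zero.1 h3 1 one_pos, eventually_ge_atTop 1] with n h4 h5
  rw [← ENNReal.ofReal_le_iff_le_toReal (ENNReal.add_ne_top.2 ⟨ENNReal.one_ne_top, h2.ne⟩)]
  refine (h1 n).trans (add_le_add h4 ?_)
  exact le_iSup₂ (f := fun n (_ : 1 ≤ n) =>
    condLExp (M.C n) μ (fun ω' => ENNReal.ofReal (frob (Xihat n ω'))) ω) n h5

end NetworkModel

theorem tendsto_zero_of_ofReal_mul_le {a r : ℕ → ℝ≥0∞} {c : ℝ} (hc : 0 < c)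
    (hr : Tendsto r atTop (𝓝 0)) (h : ∀ᶠ n in atTop, ENNReal.ofReal c * a n ≤ r n) :
    Tendsto a atTop (𝓝 0) := by
  have h1 : Tendsto (fun n => (ENNReal.ofReal c)⁻¹ * r n) atTop (𝓝 0) := by
    simpa using ENNReal.Tendsto.const_mul hr
      (Or.inr (ENNReal.inv_ne_top.2 (ENNReal.ofReal_pos.2 hc).ne'))
  refine tendsto_of_tendsto_of_tendsto_of_le_of_le' tendsto_const_nhds h1
    (Eventually.of_forall fun _ => zero_le) ?_
  filter_upwards [h] with n hn
  rw [← ENNReal.mul_le_iff_le_inv (ENNReal.ofReal_pos.2 hc).ne' ENNReal.ofReal_ne_top]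
  exact hn

namespace NetworkModel

variable {Ω : Type*} {kz kx q : ℕ} {M : NetworkModel Ω kz kx q} [MeasurableSpace Ω]
  {μ : Measure Ω} [IsProbabilityMeasure μ]

/-- The estimator leaves small balls around parameters at which the population objective stays
above a positive level. -/
theorem ae_tendsto_condLExp_near (hM : M.IsMeasurable) (hS : M.ShockAssumption μ) {K : ℕ}
    (hE : M.ExposureAssumption K) {t t' : Expo q} {Θ : Set (Param kz kx)}
    (hR : M.RegularityLLN μ t t' Θ) {Xihat Xi : ℕ → Ω → Matrix (PIdx kz kx) (PIdx kz kx) ℝ}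
    (hW : M.WeightAssumption μ Xihat Xi) (hI : M.IsIdentified μ t t' Θ Xi (M.trueParam t t'))
    {βhat : ℕ → Ω → Param kz kx} (hβm : ∀ n, Measurable (βhat n))
    (hβmin : ∀ n, 1 ≤ n → ∀ᵐ ω ∂μ, βhat n ω ∈ Θ ∧
      ∀ β ∈ Θ, M.QHat t t' Xihat n (βhat n ω) ω ≤ M.QHat t t' Xihat n β ω)
    {B L : ℝ} (hB0 : 0 ≤ B) (hL0 : 0 ≤ L)
    (hB : ∀ β ∈ Θ, ∀ n i G x z w, (w, x, z) ∈ M.dataSupport μ n i G →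
      ‖moment t t' G i w x z β‖ ≤ B)
    (hL : ∀ n i G x z w, (w, x, z) ∈ M.dataSupport μ n i G → ∀ β ∈ Θ, ∀ β' ∈ Θ,
      ‖moment t t' G i w x z β - moment t t' G i w x z β'‖ ≤ L * ‖β - β'‖)
    {β : Param kz kx} (hβ : β ∈ Θ) (d : ℝ) :
    ∀ᵐ ω ∂μ, ∀ R c : ℝ, 0 < c → (∀ᶠ n in atTop, frob (Xi n ω) ≤ R) →
      (∀ᶠ n in atTop, c ≤ M.QPop μ t t' Xi n β ω - frob (Xi n ω) * (2 * B * (L * d))) →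
      Tendsto (fun n => condLExp (M.C n) μ ({ω' | ‖β - βhat n ω'‖ ≤ d}.indicator fun _ => 1) ω)
        atTop (𝓝 0) := by
  set β₀ := M.trueParam t t' with hβ₀
  have hlam : |M.lam| < 4 := hR.peer β₀ hI.mem
  let Δ : Param kz kx → ℕ → Ω → ℝ≥0∞ := fun b n ω =>
    ENNReal.ofReal ‖M.gHat t t' n b ω - M.gPop μ t t' n b ω‖
  -- `h n` depends on the common shocks only, so it can be pulled out of the conditional
  -- expectation. Where it is negative, `ENNReal.ofReal` sends it to `0` and the inequality is
  -- trivial.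
  let h : ℕ → Ω → ℝ := fun n ω =>
    M.QPop μ t t' Xi n β ω - frob (Xi n ω) * (2 * B * (L * d))
  have hΔm : ∀ b ∈ Θ, ∀ n, Measurable (Δ b n) := fun b hb n =>
    (((measurable_gHat hM hlam t t' n (hR.peer b hb)).sub
      ((measurable_gPop t t' n b).mono (hM.le n) le_rfl)).norm).ennreal_ofReal
  have hFm : ∀ n, Measurable[M.C n] fun ω => frob (Xi n ω) := fun n =>
    measurable_frob (hW.measurable_pop n)
  have hhm : ∀ n, Measurable[M.C n] (h n) := fun n =>
    (measurable_quad (hW.measurable_pop n) (measurable_gPop t t' n β)).sub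
      ((hFm n).mul_const _)
  have hdiff : ∀ n, Measurable fun ω => ENNReal.ofReal (frob (Xihat n ω - Xi n ω)) := fun n =>
    (measurable_frob fun a b => (hW.measurable_hat n a b).sub
      ((hW.measurable_pop n a b).mono (hM.le n) le_rfl)).ennreal_ofReal
  have hEm : ∀ n, MeasurableSet {ω' | ‖β - βhat n ω'‖ ≤ d} := fun n =>
    measurableSet_le ((measurable_const.sub (hβm n)).norm) measurable_const
  have key : ∀ n, 1 ≤ n → ∀ᵐ ω ∂μ,
      ENNReal.ofReal (h n ω) *
        condLExp (M.C n) μ ({ω' | ‖β - βhat n ω'‖ ≤ d}.indicator fun _ => 1) ω ≤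
      ENNReal.ofReal (frob (Xi n ω)) * (ENNReal.ofReal (2 * B) * condLExp (M.C n) μ (Δ β n) ω
        + ENNReal.ofReal B * condLExp (M.C n) μ (Δ β₀ n) ω)
      + ENNReal.ofReal (2 * B ^ 2) *
        condLExp (M.C n) μ (fun ω' => ENNReal.ofReal (frob (Xihat n ω' - Xi n ω'))) ω := by
    intro n hn
    have hpt : ∀ᵐ ω ∂μ, ENNReal.ofReal (h n ω) *
        ({ω' | ‖β - βhat n ω'‖ ≤ d}.indicator (fun _ => (1 : ℝ≥0∞))) ω ≤
        ENNReal.ofReal (frob (Xi n ω)) * (ENNReal.ofReal (2 * B) * Δ β n ω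
          + ENNReal.ofReal B * Δ β₀ n ω)
        + ENNReal.ofReal (2 * B ^ 2) * ENNReal.ofReal (frob (Xihat n ω - Xi n ω)) := by
      filter_upwards [hβmin n hn, hI.moment_eq_zero n hn,
        ae_norm_gPop_le hM hlam (hR.peer β hβ) hB0 (hB β hβ) n,
        ae_gHat_bounded_lipschitz hM hlam hB0 hL0 hB hL n] with ω h1 h2 h3 h4
      by_cases hω : ω ∈ {ω' | ‖β - βhat n ω'‖ ≤ d}
      · rw [Set.indicator_of_mem hω, mul_one]
        have hd : ‖M.gHat t t' n β ω - M.gHat t t' n (βhat n ω) ω‖ ≤ L * d :=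
          (h4.2 β hβ _ h1.1).trans (mul_le_mul_of_nonneg_left hω hL0)
        have hq := quad_le_of_quad_le (A := Xi n ω) h3 (h4.1 β hβ) (h4.1 _ h1.1)
          (h4.1 β₀ hI.mem) h2 hd (h1.2 β₀ hI.mem)
        simp only [Δ]
        rw [← ENNReal.ofReal_mul (by positivity), ← ENNReal.ofReal_mul hB0,
          ← ENNReal.ofReal_add (by positivity) (by positivity),
          ← ENNReal.ofReal_mul (frob_nonneg _), ← ENNReal.ofReal_mul (by positivity),
          ← ENNReal.ofReal_add (mul_nonneg (frob_nonneg _) (by positivity))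
            (mul_nonneg (by positivity) (frob_nonneg _))]
        exact ENNReal.ofReal_le_ofReal hq
      · rw [Set.indicator_of_notMem hω, mul_zero]
        exact zero_le
    have hm := hM.le n
    have c1 := condLExp_mul_of_measurable_left (μ := μ) hm (hhm n).ennreal_ofReal
      ((measurable_const (a := (1 : ℝ≥0∞))).indicator (hEm n))
    have c2 := condLExp_mul_of_measurable_left (μ := μ) hm (hFm n).ennreal_ofReal
      (((hΔm β hβ n).const_mul (ENNReal.ofReal (2 * B))).add
        ((hΔm β₀ hI.mem n).const_mul (ENNReal.ofReal B)))
    have c3 := condLExp_add_right (mΩ := M.C n) (P := μ)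
      (fun ω => ENNReal.ofReal (2 * B) * Δ β n ω)
      ((hΔm β₀ hI.mem n).const_mul (ENNReal.ofReal B)).aemeasurable
    have c4 := condLExp_mul_of_measurable_left (μ := μ) hm
      (measurable_const (a := ENNReal.ofReal (2 * B))) (hΔm β hβ n)
    have c5 := condLExp_mul_of_measurable_left (μ := μ) hm
      (measurable_const (a := ENNReal.ofReal B)) (hΔm β₀ hI.mem n)
    have c6 := condLExp_mul_of_measurable_left (μ := μ) hm
      (measurable_const (a := ENNReal.ofReal (2 * B ^ 2))) (hdiff n)
    have c7 := condLExp_add_right (mΩ := M.C n) (P := μ)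
      (fun ω => ENNReal.ofReal (frob (Xi n ω)) * (ENNReal.ofReal (2 * B) * Δ β n ω
          + ENNReal.ofReal B * Δ β₀ n ω))
      ((hdiff n).const_mul (ENNReal.ofReal (2 * B ^ 2))).aemeasurable
    have c8 := condLExp_mono (mΩ := M.C n) hpt
    filter_upwards [c1, c2, c3, c4, c5, c6, c7, c8] with ω c1 c2 c3 c4 c5 c6 c7 c8
    rw [← c1, ← c4, ← c5, ← c6]
    refine c8.trans (c7.trans_le ?_)
    simp only [Pi.add_apply] at c3 ⊢
    rw [← c3]
    exact add_le_add c2.le le_rfl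
  have key' : ∀ᵐ ω ∂μ, ∀ n, 1 ≤ n → _ := ae_all_iff.2 fun n => by
    by_cases hn : 1 ≤ n
    · filter_upwards [key n hn] with ω hω _ using hω
    · exact ae_of_all _ fun ω hn' => absurd hn' hn
  -- The null set is discarded before `R` and `c` are introduced, so both may later depend on `ω`.
  filter_upwards [key', hW.tendsto,
    tendsto_condLExp_norm_gHat_sub_gPop hM hS hE hR hlam hβ,
    tendsto_condLExp_norm_gHat_sub_gPop hM hS hE hR hlam hI.mem] with ω h1 h2 h3 h4 R c hc hRev hcev
  have l1 := ENNReal.Tendsto.const_mul h3 (Or.inr (ENNReal.ofReal_ne_top (r := 2 * B)))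
  have l2 := ENNReal.Tendsto.const_mul h4 (Or.inr (ENNReal.ofReal_ne_top (r := B)))
  have l3 := ENNReal.Tendsto.const_mul (l1.add l2) (Or.inr (ENNReal.ofReal_ne_top (r := R)))
  have l4 := ENNReal.Tendsto.const_mul h2 (Or.inr (ENNReal.ofReal_ne_top (r := 2 * B ^ 2)))
  have l5 := l3.add l4
  simp only [mul_zero, add_zero] at l5
  refine tendsto_zero_of_ofReal_mul_le hc l5 ?_
  filter_upwards [hRev, hcev, eventually_ge_atTop 1] with n hn1 hn2 hn3
  refine (mul_le_mul' (ENNReal.ofReal_le_ofReal hn2) le_rfl).trans ((h1 n hn3).trans ?_)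
  exact add_le_add (mul_le_mul' (ENNReal.ofReal_le_ofReal hn1) le_rfl) le_rfl

end NetworkModel

/-- Convergence to zero of conditional probabilities yields convergence to zero of the
probabilities. -/
theorem tendsto_measure_of_ae_tendsto_condLExp {Ω : Type*} [MeasurableSpace Ω] {μ : Measure Ω}
    [IsProbabilityMeasure μ] {C : ℕ → MeasurableSpace Ω} (hC : ∀ n, C n ≤ ‹MeasurableSpace Ω›)
    {s : ℕ → Set Ω} (hs : ∀ n, MeasurableSet (s n))
    (h : ∀ᵐ ω ∂μ, Tendsto (fun n => condLExp (C n) μ ((s n).indicator fun _ => 1) ω) atTop (𝓝 0)) :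
    Tendsto (fun n => μ (s n)) atTop (𝓝 0) := by
  have h1 : ∀ n, μ (s n) = ∫⁻ ω, condLExp (C n) μ ((s n).indicator fun _ => 1) ω ∂μ := fun n => by
    rw [lintegral_condLExp (hC n), lintegral_indicator (hs n)]
    simp
  simp_rw [h1]
  -- Conditional probabilities are dominated by the constant `1`.
  have h2 := tendsto_lintegral_of_dominated_convergence (μ := μ) (f := fun _ => 0)
    (F := fun n => condLExp (C n) μ ((s n).indicator fun _ => 1)) (fun _ => 1)
    (fun n => measurable_condLExp' _ _ _) (fun n => ?_) (by simp) h
  · simpa using h2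
  · have := condLExp_mono (mΩ := C n) (P := μ) (X := (s n).indicator fun _ => 1)
      (Y := fun _ => 1) (ae_of_all _ fun ω => Set.indicator_le_self' (fun _ _ => zero_le) ω)
    rwa [condLExp_const (hC n)] at this

namespace NetworkModel

variable {Ω : Type*} {kz kx q : ℕ} {M : NetworkModel Ω kz kx q} [MeasurableSpace Ω]
  {μ : Measure Ω} [IsProbabilityMeasure μ]

/-- Compactness leaves finitely many balls for the estimator to avoid, and a union bound adds their
conditional probabilities. -/
theorem ae_tendsto_condLExp_far (hM : M.IsMeasurable) (hS : M.ShockAssumption μ) {K : ℕ}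
    (hE : M.ExposureAssumption K) {t t' : Expo q} {Θ : Set (Param kz kx)}
    (hR : M.RegularityLLN μ t t' Θ) {Xihat Xi : ℕ → Ω → Matrix (PIdx kz kx) (PIdx kz kx) ℝ}
    (hW : M.WeightAssumption μ Xihat Xi) (hI : M.IsIdentified μ t t' Θ Xi (M.trueParam t t'))
    {βhat : ℕ → Ω → Param kz kx} (hβm : ∀ n, Measurable (βhat n))
    (hβmin : ∀ n, 1 ≤ n → ∀ᵐ ω ∂μ, βhat n ω ∈ Θ ∧
      ∀ β ∈ Θ, M.QHat t t' Xihat n (βhat n ω) ω ≤ M.QHat t t' Xihat n β ω)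
    {ε : ℝ} (hε : 0 < ε) :
    ∀ᵐ ω ∂μ, Tendsto (fun n => condLExp (M.C n) μ
      ({ω' | ε < ‖βhat n ω' - M.trueParam t t'‖}.indicator fun _ => 1) ω) atTop (𝓝 0) := by
  set β₀ := M.trueParam t t'
  obtain ⟨B, hB0, hB⟩ := hR.exists_uniform_bound hI.mem
  obtain ⟨L, hL0, hL⟩ := hR.equicontinuous
  obtain ⟨κ, hκ, hsep⟩ := hI.separated ε hε
  let Θε : Set (Param kz kx) := Θ ∩ {β | ε ≤ ‖β - β₀‖}
  have hcomp : IsCompact Θε := hR.compact.inter_right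
    (isClosed_le continuous_const (continuous_id.sub continuous_const).norm)
  -- The radius needed depends on `ω` through `κ` and the bound on `Xi`, while identification and
  -- the law of large numbers have a null set for each parameter. Finite covers at countably many
  -- radii leave countably many centres, hence one common null set.
  let δ : ℕ → ℝ := fun m => 1 / ((m : ℝ) + 1)
  have hδ : ∀ m, 0 < δ m := fun m => Nat.one_div_pos_of_nat
  choose N hNΘ hNfin hNcov using fun m => hcomp.finite_cover_balls (hδ m)
  have hcover : ∀ n, 1 ≤ n → ∀ m, ∀ᵐ ω ∂μ,
      condLExp (M.C n) μ ({ω' | ε < ‖βhat n ω' - β₀‖}.indicator fun _ => 1) ω ≤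
      ∑ β ∈ (hNfin m).toFinset,
        condLExp (M.C n) μ ({ω' | ‖β - βhat n ω'‖ ≤ δ m}.indicator fun _ => 1) ω := by
    intro n hn m
    have hm : ∀ β : Param kz kx, AEMeasurable
        ({ω' | ‖β - βhat n ω'‖ ≤ δ m}.indicator fun _ => (1 : ℝ≥0∞)) μ := fun β =>
      (measurable_const.indicator (measurableSet_le ((measurable_const.sub (hβm n)).norm)
        measurable_const)).aemeasurable
    have h1 := condLExp_finsetSum (P := μ) (M.C n) (hNfin m).toFinset hm
    have h2 := condLExp_mono (mΩ := M.C n) (P := μ)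
      (X := {ω' | ε < ‖βhat n ω' - β₀‖}.indicator fun _ => 1)
      (Y := ∑ β ∈ (hNfin m).toFinset, {ω' | ‖β - βhat n ω'‖ ≤ δ m}.indicator fun _ => 1) (by
        filter_upwards [hβmin n hn] with ω hω
        by_cases hωε : ω ∈ {ω' | ε < ‖βhat n ω' - β₀‖}
        · have hle : ε ≤ ‖βhat n ω - β₀‖ := le_of_lt hωε
          obtain ⟨β, hβN, hβ⟩ := Set.mem_iUnion₂.1 (hNcov m ⟨hω.1, hle⟩)
          have hβ' : ω ∈ {ω' | ‖β - βhat n ω'‖ ≤ δ m} := by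
            have := Metric.mem_ball'.1 hβ
            rw [dist_eq_norm] at this
            exact this.le
          rw [Set.indicator_of_mem hωε, Finset.sum_apply]
          refine le_trans ?_ (Finset.single_le_sum (fun _ _ => zero_le)
            ((hNfin m).mem_toFinset.2 hβN))
          rw [Set.indicator_of_mem hβ']
        · rw [Set.indicator_of_notMem hωε]
          exact zero_le)
    filter_upwards [h1, h2] with ω h1 h2
    rw [h1, Finset.sum_apply] at h2
    exact h2
  have hcover' : ∀ᵐ ω ∂μ, ∀ n, 1 ≤ n → ∀ m, _ := ae_all_iff.2 fun n => by
    by_cases hn : 1 ≤ n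
    · filter_upwards [ae_all_iff.2 (hcover n hn)] with ω hω _ using hω
    · exact ae_of_all _ fun ω hn' => absurd hn' hn
  have hnear := fun m β (hβ : β ∈ N m) => ae_tendsto_condLExp_near hM hS hE hR hW hI hβm hβmin
    hB0 hL0.le hB hL (hNΘ m hβ).1 (δ m)
  have hnear' := ae_all_iff.2 fun m =>
    (ae_ball_iff (hNfin m).countable).2 (hnear m)
  have hsep' := ae_all_iff.2 fun m =>
    (ae_ball_iff (hNfin m).countable).2 fun β hβ => hsep β (hNΘ m hβ).1 (hNΘ m hβ).2
  filter_upwards [hcover', hnear', hsep', hκ, hW.ae_eventually_frob_le hM] with ω h1 h2 h3 h4 h5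
  obtain ⟨R, hRω⟩ := h5
  set R' := max R 0
  have hRω' : ∀ᶠ n in atTop, frob (Xi n ω) ≤ R' := hRω.mono fun n hn => hn.trans (le_max_left _ _)
  have hR0 : 0 ≤ R' := le_max_right _ _
  -- The error from moving a centre to the estimator uses at most half of the separation `κ ω`; the
  -- other half is the level `c` in `ae_tendsto_condLExp_near`.
  obtain ⟨m, hm⟩ : ∃ m, R' * (2 * B * (L * δ m)) ≤ κ ω / 2 := by
    have hlim : Tendsto (fun m => R' * (2 * B * (L * δ m))) atTop (𝓝 (R' * (2 * B * (L * 0)))) :=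
      ((tendsto_one_div_add_atTop_nhds_zero_nat.const_mul L).const_mul (2 * B)).const_mul R'
    simp only [mul_zero] at hlim
    exact ((hlim.eventually (Iio_mem_nhds (half_pos h4))).exists).imp fun m hm => le_of_lt hm
  have hzero : Tendsto (fun n => ∑ β ∈ (hNfin m).toFinset,
      condLExp (M.C n) μ ({ω' | ‖β - βhat n ω'‖ ≤ δ m}.indicator fun _ => 1) ω) atTop (𝓝 0) := by
    rw [← Finset.sum_const_zero (s := (hNfin m).toFinset)]
    refine tendsto_finsetSum _ fun β hβ => ?_
    have hβN := (hNfin m).mem_toFinset.1 hβ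
    refine h2 m β hβN R' (κ ω / 2) (half_pos h4) hRω' ?_
    filter_upwards [h3 m β hβN, hRω'] with n hn1 hn2
    have : frob (Xi n ω) * (2 * B * (L * δ m)) ≤ R' * (2 * B * (L * δ m)) :=
      mul_le_mul_of_nonneg_right hn2 (by have := hδ m; positivity)
    linarith
  refine tendsto_of_tendsto_of_tendsto_of_le_of_le' tendsto_const_nhds hzero
    (Eventually.of_forall fun _ => zero_le) ?_
  filter_upwards [eventually_ge_atTop 1] with n hn using h1 n hn m

end NetworkModel

end NetworkGMM

end

/-! ### The theorem -/

open NetworkGMM in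
theorem mainTheorem5 {Ω : Type*} [MeasurableSpace Ω] (μ : Measure Ω) [IsProbabilityMeasure μ]
    {kz kx q : ℕ} (M : NetworkModel Ω kz kx q) (t t' : Expo q) (K : ℕ)
    (Θ : Set (Param kz kx))
    (Xihat Xi : ℕ → Ω → Matrix (PIdx kz kx) (PIdx kz kx) ℝ)
    (βhat : ℕ → Ω → Param kz kx)
    (hmeas : M.IsMeasurable)
    (hshock : M.ShockAssumption μ)
    (hexpo : M.ExposureAssumption K)
    (hreg : M.RegularityLLN μ t t' Θ)
    (hweight : M.WeightAssumption μ Xihat Xi)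
    (hident : M.IsIdentified μ t t' Θ Xi (M.trueParam t t'))
    (hβ_meas : ∀ n, Measurable (βhat n))
    (hβ_min : ∀ n, 1 ≤ n → ∀ᵐ ω ∂μ, βhat n ω ∈ Θ ∧
      ∀ β ∈ Θ, M.QHat t t' Xihat n (βhat n ω) ω ≤ M.QHat t t' Xihat n β ω) :
    (∀ ε : ℝ, 0 < ε → ∀ᵐ ω ∂μ, Tendsto
      (fun n => (μ⟦{ω' | ε < ‖βhat n ω' - M.trueParam t t'‖} | M.C n⟧) ω) atTop (𝓝 0)) ∧
    TendstoInMeasure μ βhat atTop (fun _ => M.trueParam t t') := by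
  have hfar := fun {ε : ℝ} (hε : 0 < ε) => NetworkModel.ae_tendsto_condLExp_far hmeas hshock hexpo
    hreg hweight hident hβ_meas hβ_min hε
  have hset : ∀ (ε : ℝ) n, MeasurableSet {ω' | ε < ‖βhat n ω' - M.trueParam t t'‖} := fun ε n =>
    measurableSet_lt measurable_const ((hβ_meas n).sub measurable_const).norm
  refine ⟨fun ε hε => ?_, ?_⟩
  · filter_upwards [hfar hε,
      ae_all_iff.2 fun n => ofReal_condExp_indicator (μ := μ) (hmeas.le n) (hset ε n),
      ae_all_iff.2 fun n => condExp_nonneg (μ := μ) (m := M.C n)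
        (f := {ω' | ε < ‖βhat n ω' - M.trueParam t t'‖}.indicator fun _ => (1 : ℝ))
        (ae_of_all _ fun ω => Set.indicator_nonneg (fun _ _ => zero_le_one) ω)] with ω h1 h2 h3
    simp_rw [← h2] at h1
    have h4 := (ENNReal.tendsto_toReal ENNReal.zero_ne_top).comp h1
    simp only [ENNReal.toReal_zero] at h4
    refine h4.congr fun n => ?_
    exact ENNReal.toReal_ofReal (h3 n)
  · rw [tendstoInMeasure_iff_norm]
    intro ε hε
    -- Convergence in measure uses the event with `ε ≤`, which lies in the strict event at level `ε
    -- / 2`.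
    refine tendsto_of_tendsto_of_tendsto_of_le_of_le tendsto_const_nhds
      (tendsto_measure_of_ae_tendsto_condLExp hmeas.le (hset (ε / 2)) (hfar (half_pos hε)))
      (fun _ => zero_le) fun n => measure_mono fun ω hω => ?_
    exact lt_of_lt_of_le (half_lt_self hε) hω
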